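/- Let $p$ be an odd prime, $n\ge 0$, and let $H_n = E(x_1,\dots,x_n)\otimes P[y_1,\dots,y_n] \cong H^*(B(\mathbb Z/p)^n;\mathbb F_p)$ be the tensor product of the exterior and the polynomial algebra over $\mathbb F_p$, graded by $|x_i|=1$, $|y_i|=2$. The group $GL_n=GL_n(\mathbb F_p)$ acts on $H_n$ by algebra automorphisms, by the same linear substitutions of the $x_i$ and of the $y_i$. The mod $p$ Steenrod algebra $\mathcal A$, generated by the Bockstein $\beta$ and the reduced powers $P^k$, acts on $H_n$ by the Cartan formula, $\beta$ being a graded derivation, with $\beta x_i=y_i$, $\beta y_i=0$, $P^0=1$, $P^kx_i=0$ for $k\ge1$, $P^1y_i=y_i^p$, $P^ky_i=0$ for $k\ge 2$; this action commutes with $GL_n$. Let $D_n=H_n^{GL_n}$ be the extended Dickson algebra, a graded $\mathcal A$-module, let $D_n^k$ be its part of degree $k$, and let $\overline{D_n}=\bigoplus_{k>0}D_n^k$ be its augmentation ideal. Then $D_n$ is atomic as a module over the Steenrod algebra, in the following sense. Let $f:D_n\to D_n$ be a degree-preserving $\mathcal A$-linear map, let $r$ be the least positive degree with $D_n^r\ne0$,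 and suppose that $f$ is nonzero on $D_n^r$ (for instance, an isomorphism of $D_n^r$). Then $f$ restricts to an isomorphism $D_n^k\to D_n^k$ for every $k>0$, hence to an isomorphism of $\overline{D_n}$; and $f$ is an isomorphism of $D_n$ if and only if $f(1)\neq0$. -/

import Mathlib

open scoped TensorProduct

noncomputable section

namespace ExtendedDickson

/-- The exterior algebra `E(x₁,…,xₙ)` over `𝔽_p`; `xᵢ` is `ι` of the `i`-th standard vector. -/
abbrev E (p n : ℕ) : Type := ExteriorAlgebra (ZMod p) (Fin n → ZMod p)

/-- The polynomial algebra `P[y₁,…,yₙ]` over `𝔽_p`. -/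
abbrev P (p n : ℕ) : Type := MvPolynomial (Fin n) (ZMod p)

/-- `H^*(BVⁿ; 𝔽_p) = E(x₁,…,xₙ) ⊗ P[y₁,…,yₙ]` (`p` odd).  As the `yᵢ` have even degree, the graded
tensor product of algebras is the ordinary one. -/
def H (p n : ℕ) : Type := E p n ⊗[ZMod p] P p n

instance (p n : ℕ) : Ring (H p n) := inferInstanceAs (Ring (E p n ⊗[ZMod p] P p n))

instance (p n : ℕ) : Algebra (ZMod p) (H p n) :=
  inferInstanceAs (Algebra (ZMod p) (E p n ⊗[ZMod p] P p n))

/-- The element `e ⊗ f` of `E ⊗ P`. -/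
def tensor {p n : ℕ} (e : E p n) (f : P p n) : H p n := e ⊗ₜ[ZMod p] f

/-- The linear map `e ⊗ f ↦ a e ⊗ b f`. -/
def tensorMap {p n : ℕ} (a : E p n →ₗ[ZMod p] E p n) (b : P p n →ₗ[ZMod p] P p n) :
    Module.End (ZMod p) (H p n) :=
  TensorProduct.map a b

/-- The degree `k` part of `E ⊗ P`, where `|xᵢ| = 1` and `|yᵢ| = 2`. -/
def degreePart (p n k : ℕ) : Submodule (ZMod p) (H p n) :=
  Submodule.span (ZMod p)
    {z | ∃ (i j : ℕ) (e : E p n) (f : P p n), i + 2 * j = k ∧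
      e ∈ (⋀[ZMod p]^i (Fin n → ZMod p)) ∧ f.IsHomogeneous j ∧ z = tensor e f}

/-! ### The action of the general linear group -/

/-- The substitution `yⱼ ↦ ∑ᵢ gᵢⱼ yᵢ` of a matrix `g` in the polynomial algebra. -/
def polyAct {p n : ℕ} (g : Matrix (Fin n) (Fin n) (ZMod p)) : P p n →ₐ[ZMod p] P p n :=
  MvPolynomial.aeval fun j => ∑ i, g i j • MvPolynomial.X i

/-- The algebra endomorphism `xⱼ ↦ ∑ᵢ gᵢⱼ xᵢ`, `yⱼ ↦ ∑ᵢ gᵢⱼ yᵢ` of `E ⊗ P`. -/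
def act {p n : ℕ} (g : Matrix (Fin n) (Fin n) (ZMod p)) : H p n →ₐ[ZMod p] H p n :=
  Algebra.TensorProduct.map (ExteriorAlgebra.map (Matrix.mulVecLin g)) (polyAct g)

/-- The extended Dickson algebra `(E ⊗ P)^{GLₙ}`. -/
def dicksonSubalgebra (p n : ℕ) : Subalgebra (ZMod p) (H p n) :=
  ⨅ g : GL (Fin n) (ZMod p),
    AlgHom.equalizer (act (g : Matrix (Fin n) (Fin n) (ZMod p))) (AlgHom.id (ZMod p) (H p n))

/-! ### The Steenrod operations -/

/-- The total reduced power on the polynomial algebra: the algebra map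
`∑ₖ Pᵏ Tᵏ : P[y] → P[y][T]` with `yⱼ ↦ yⱼ + yⱼᵖ T`. -/
def totalPower (p n : ℕ) : P p n →ₐ[ZMod p] Polynomial (P p n) :=
  MvPolynomial.aeval fun j =>
    Polynomial.C (MvPolynomial.X j) + Polynomial.C (MvPolynomial.X j ^ p) * Polynomial.X

/-- The reduced power `Pᵏ` on the polynomial algebra. -/
def polyPower (p n k : ℕ) : P p n →ₗ[ZMod p] P p n :=
  ((Polynomial.lcoeff (P p n) k).restrictScalars (ZMod p)) ∘ₗ (totalPower p n).toLinearMap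

/-- The reduced power `Pᵏ` on `E ⊗ P`.  As `P⁰ xᵢ = xᵢ` and `Pᵏ xᵢ = 0` for `k > 0`, the Cartan
formula gives `Pᵏ (e ⊗ f) = e ⊗ Pᵏ f`. -/
def power (p n k : ℕ) : Module.End (ZMod p) (H p n) :=
  tensorMap LinearMap.id (polyPower p n k)

/-- The antiderivation `∂/∂xᵢ` of `E(x₁,…,xₙ)`: contraction with the `i`-th coordinate form. -/
def partialX {p n : ℕ} (i : Fin n) : E p n →ₗ[ZMod p] E p n :=
  CliffordAlgebra.contractLeft (Q := (0 : QuadraticForm (ZMod p) (Fin n → ZMod p)))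
    (LinearMap.proj i)

/-- The Bockstein on `E ⊗ P`: the derivation (with `β (a b) = (β a) b + (-1)^|a| a (β b)`) such that
`β xᵢ = yᵢ` and `β yᵢ = 0`, that is, `β = ∑ᵢ ∂/∂xᵢ ⊗ yᵢ`. -/
def bockstein (p n : ℕ) : Module.End (ZMod p) (H p n) :=
  ∑ i : Fin n, tensorMap (partialX i) (LinearMap.mulLeft (ZMod p) (MvPolynomial.X i))

/-- The mod `p` Steenrod algebra (`p` odd), as the algebra of natural operations on the cohomology
of elementary abelian `p`-groups that is generated by the Bockstein and the reduced powers.  (The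
Steenrod algebra acts faithfully on the family of all `H^*(BVᵐ; 𝔽_p)`.) -/
def steenrodSubalgebra (p : ℕ) : Subalgebra (ZMod p) ((m : ℕ) → Module.End (ZMod p) (H p m)) :=
  Algebra.adjoin (ZMod p)
    (insert (fun m => bockstein p m) (Set.range fun k : ℕ => fun m => power p m k))

/-- The mod `p` Steenrod algebra, as a ring. -/
def SteenrodAlgebra (p : ℕ) : Type := steenrodSubalgebra p

instance (p : ℕ) : Ring (SteenrodAlgebra p) := inferInstanceAs (Ring (steenrodSubalgebra p))

instance (p : ℕ) : Algebra (ZMod p) (SteenrodAlgebra p) :=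
  inferInstanceAs (Algebra (ZMod p) (steenrodSubalgebra p))

/-- The action of the Steenrod algebra on `E ⊗ P`. -/
def steenrodAct (p n : ℕ) : SteenrodAlgebra p →ₐ[ZMod p] Module.End (ZMod p) (H p n) :=
  (Pi.evalAlgHom (ZMod p) (fun m => Module.End (ZMod p) (H p m)) n).comp (steenrodSubalgebra p).val

/-- `E ⊗ P` is a module over the Steenrod algebra. -/
instance (p n : ℕ) : Module (SteenrodAlgebra p) (H p n) :=
  Module.compHom (H p n) (steenrodAct p n).toRingHom

theorem smul_eq_steenrodAct {p n : ℕ} (a : SteenrodAlgebra p) (z : H p n) :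
    a • z = steenrodAct p n a z := rfl

/-! ### The operations on elements `e ⊗ f` -/

theorem tensor_induction {p n : ℕ} {C : H p n → Prop} (zero : C 0)
    (tensor : ∀ e f, C (tensor e f)) (add : ∀ a b, C a → C b → C (a + b)) (z : H p n) : C z :=
  TensorProduct.induction_on z zero tensor add

theorem act_tensor {p n : ℕ} (g : Matrix (Fin n) (Fin n) (ZMod p)) (e : E p n) (f : P p n) :
    act g (tensor e f) = tensor (ExteriorAlgebra.map (Matrix.mulVecLin g) e) (polyAct g f) := rfl

theorem power_tensor {p n : ℕ} (k : ℕ) (e : E p n) (f : P p n) :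
    power p n k (tensor e f) = tensor e (polyPower p n k f) := rfl

theorem bockstein_tensor {p n : ℕ} (e : E p n) (f : P p n) :
    bockstein p n (tensor e f) =
      ∑ i : Fin n, tensor (partialX i e) (MvPolynomial.X i * f) := by
  rw [bockstein, LinearMap.sum_apply]
  rfl

theorem tensor_sum_left {p n : ℕ} {ι : Type} (s : Finset ι) (e : ι → E p n) (f : P p n) :
    tensor (∑ i ∈ s, e i) f = ∑ i ∈ s, tensor (e i) f :=
  TensorProduct.sum_tmul s e f

theorem tensor_sum_right {p n : ℕ} {ι : Type} (s : Finset ι) (e : E p n) (f : ι → P p n) :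
    tensor e (∑ i ∈ s, f i) = ∑ i ∈ s, tensor e (f i) :=
  TensorProduct.tmul_sum e s f

theorem tensor_smul_comm {p n : ℕ} (c : ZMod p) (e : E p n) (f : P p n) :
    tensor (c • e) f = tensor e (c • f) :=
  TensorProduct.smul_tmul c e f

/-! ### The Steenrod operations commute with the general linear group -/

theorem polyPower_polyAct {p n : ℕ} [Fact p.Prime] (g : Matrix (Fin n) (Fin n) (ZMod p)) (k : ℕ)
    (f : P p n) : polyPower p n k (polyAct g f) = polyAct g (polyPower p n k f) := by
  have h : (totalPower p n).comp (polyAct g) =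
      (Polynomial.mapAlgHom (polyAct g)).comp (totalPower p n) := by
    apply MvPolynomial.algHom_ext
    intro j
    simp only [AlgHom.comp_apply, polyAct, totalPower, MvPolynomial.aeval_X, map_sum, map_smul,
      map_add, map_mul, Polynomial.coe_mapAlgHom, Polynomial.map_C, Polynomial.map_X,
      RingHom.coe_coe, map_pow, smul_add, Finset.sum_add_distrib]
    congr 1
    · exact Finset.sum_congr rfl fun i _ => Polynomial.smul_C _ _
    · rw [sum_pow_char, Finset.sum_mul]
      refine Finset.sum_congr rfl fun i _ => ?_
      have hc : (g i j • (MvPolynomial.X i : P p n)) ^ p = g i j • MvPolynomial.X i ^ p := by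
        rw [smul_pow, ZMod.pow_card]
      rw [← smul_mul_assoc, ← Polynomial.C_pow, Polynomial.smul_C, ← hc, Polynomial.C_pow]
  have h' := congrArg (fun q => Polynomial.coeff q k) (DFunLike.congr_fun h f)
  simpa [polyPower] using h'

theorem power_act {p n : ℕ} [Fact p.Prime] (g : Matrix (Fin n) (Fin n) (ZMod p)) (k : ℕ)
    (z : H p n) : power p n k (act g z) = act g (power p n k z) := by
  induction z using tensor_induction with
  | zero => simp only [map_zero]
  | tensor e f => simp only [power_tensor, act_tensor, polyPower_polyAct]
  | add a b ha hb => simp only [map_add, ha, hb]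

theorem contractLeft_map {p n : ℕ} (g : Matrix (Fin n) (Fin n) (ZMod p))
    (d : Module.Dual (ZMod p) (Fin n → ZMod p)) (e : E p n) :
    CliffordAlgebra.contractLeft d (ExteriorAlgebra.map (Matrix.mulVecLin g) e) =
      ExteriorAlgebra.map (Matrix.mulVecLin g)
        (CliffordAlgebra.contractLeft (d ∘ₗ Matrix.mulVecLin g) e) := by
  induction e using CliffordAlgebra.left_induction with
  | algebraMap r =>
    rw [AlgHom.commutes, CliffordAlgebra.contractLeft_algebraMap,
      CliffordAlgebra.contractLeft_algebraMap, map_zero]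
  | add a b ha hb => simp only [map_add, ha, hb]
  | ι_mul a v ha =>
    have hv : ExteriorAlgebra.map (Matrix.mulVecLin g) (CliffordAlgebra.ι 0 v) =
        CliffordAlgebra.ι 0 (Matrix.mulVecLin g v) := ExteriorAlgebra.map_apply_ι _ _
    rw [map_mul, hv, CliffordAlgebra.contractLeft_ι_mul, CliffordAlgebra.contractLeft_ι_mul,
      map_sub, map_smul, map_mul, hv, ha]
    rfl

theorem partialX_map {p n : ℕ} (g : Matrix (Fin n) (Fin n) (ZMod p)) (i : Fin n) (e : E p n) :
    partialX i (ExteriorAlgebra.map (Matrix.mulVecLin g) e) =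
      ∑ j, g i j • ExteriorAlgebra.map (Matrix.mulVecLin g) (partialX j e) := by
  have h : (LinearMap.proj i : Module.Dual (ZMod p) (Fin n → ZMod p)) ∘ₗ Matrix.mulVecLin g =
      ∑ j, g i j • (LinearMap.proj j : Module.Dual (ZMod p) (Fin n → ZMod p)) := by
    refine LinearMap.ext fun v => ?_
    simp [Matrix.mulVec, dotProduct]
  rw [partialX, contractLeft_map, h, map_sum, LinearMap.sum_apply, map_sum]
  refine Finset.sum_congr rfl fun j _ => ?_
  rw [map_smul, LinearMap.smul_apply, map_smul]
  rfl

theorem bockstein_act {p n : ℕ} (g : Matrix (Fin n) (Fin n) (ZMod p))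
    (z : H p n) : bockstein p n (act g z) = act g (bockstein p n z) := by
  induction z using tensor_induction with
  | zero => simp only [map_zero]
  | tensor e f =>
    have hX : ∀ j, polyAct g (MvPolynomial.X j) = ∑ i, g i j • (MvPolynomial.X i : P p n) :=
      fun j => MvPolynomial.aeval_X _ _
    simp only [act_tensor, bockstein_tensor, map_sum, map_mul, hX, partialX_map, tensor_sum_left,
      Finset.sum_mul, tensor_sum_right, tensor_smul_comm, smul_mul_assoc]
    exact Finset.sum_comm
  | add a b ha hb => simp only [map_add, ha, hb]

theorem mem_dicksonSubalgebra {p n : ℕ} {z : H p n} :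
    z ∈ dicksonSubalgebra p n ↔
      ∀ g : GL (Fin n) (ZMod p), act (g : Matrix (Fin n) (Fin n) (ZMod p)) z = z := by
  simp [dicksonSubalgebra, Algebra.mem_iInf, AlgHom.mem_equalizer]

theorem smul_act {p n : ℕ} [Fact p.Prime] (g : Matrix (Fin n) (Fin n) (ZMod p))
    (a : SteenrodAlgebra p) (z : H p n) : a • act g z = act g (a • z) := by
  obtain ⟨a, ha⟩ := a
  change a n (act g z) = act g (a n z)
  induction ha using Algebra.adjoin_induction generalizing z with
  | mem x hx =>
    rcases hx with rfl | ⟨k, rfl⟩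
    · exact bockstein_act g z
    · exact power_act g k z
  | algebraMap r => simp [Pi.algebraMap_apply, Module.algebraMap_end_apply]
  | add x y _ _ hx hy => simp [hx, hy]
  | mul x y _ _ hx hy => simp [hx, hy]

/-! ### The extended Dickson algebra as a graded module over the Steenrod algebra -/

/-- The extended Dickson algebra `Dₙ = (E ⊗ P)^{GLₙ}` as a module over the Steenrod algebra. -/
def D (p n : ℕ) [Fact p.Prime] : Submodule (SteenrodAlgebra p) (H p n) where
  carrier := dicksonSubalgebra p n
  add_mem' := (dicksonSubalgebra p n).add_mem
  zero_mem' := (dicksonSubalgebra p n).zero_mem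
  smul_mem' a z hz := by
    refine mem_dicksonSubalgebra.2 fun g => ?_
    rw [← smul_act, mem_dicksonSubalgebra.1 hz g]

/-- The unit of `Dₙ`. -/
instance (p n : ℕ) [Fact p.Prime] : One (D p n) := ⟨⟨1, (dicksonSubalgebra p n).one_mem⟩⟩

/-- The degree `k` part of `Dₙ`. -/
def DDegree (p n k : ℕ) [Fact p.Prime] : AddSubgroup (D p n) :=
  (degreePart p n k).toAddSubgroup.comap (D p n).subtype.toAddMonoidHom

/-- The augmentation ideal of `Dₙ`: the sum of the parts of positive degree. -/
def DAugmentation (p n : ℕ) [Fact p.Prime] : AddSubgroup (D p n) :=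
  ⨆ k : ℕ, ⨆ _ : 0 < k, DDegree p n k

end ExtendedDickson

end

/-!
If a nonzero invariant `z` of positive degree satisfies `f z = c z`, then the `c`-eigenspace of `f`
is a Steenrod submodule of `Dₙ` containing it. Any two such submodules meet nontrivially:

* The Milnor primitives `Qᵢ` are the derivations `∑ⱼ yⱼ ^ p ^ i ∂/∂xⱼ`, so Cramer's rule for the
  Moore matrix recovers each `∂/∂xⱼ` up to a nonzero polynomial factor. Hence the submodule contains
  a nonzero invariant polynomial `h` of positive degree.
* Composing the substitutions `y ↦ y + T y ^ p` of the total reduced power, one sees that a linear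
  functional vanishing on the submodule vanishes on `h(R(y₁), …, R(yₙ))` for all additive
  polynomials `R(y) = ∑ₛ rₛ y ^ p ^ s` over an extension field. Take for `R(y)` a linear combination
  of the sums `∑ₛ (tⱼ y) ^ p ^ s`; as these almost satisfy `T ^ p = T`, only the values of `h` on
  `𝔽_p`-points matter, and by invariance a combination of these is the indicator function of `GLₙ`
  on matrices, that is, `det ^ (p - 1)`. Comparing coefficients at the monomials in `t` shows that
  the submodule contains `det(yⱼ ^ p ^ gᵢ) ^ (p - 1)` for all large exponents `gᵢ`.

So at most one eigenvalue occurs in positive degrees. In the least positive degree, the coefficients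
of an invariant are divisible by high powers of all linear forms, which leaves only the multiples of
one class; there `f` is multiplication by some `c ≠ 0`. Hence `0` is not an eigenvalue in positive
degrees, and `f` is bijective on each finite `Dₙᵏ`.
-/

open scoped TensorProduct

noncomputable section

namespace ExtendedDickson

open MvPolynomial

/-! ### Contractions and exterior powers -/

section ExteriorAlgebra

open CliffordAlgebra (contractLeft)

variable {R M N : Type*} [CommRing R] [AddCommGroup M] [Module R M] [AddCommGroup N] [Module R N]

theorem exteriorAlgebra_map_id_sub_smulRight (d : Module.Dual R M) (v : M)
    (e : ExteriorAlgebra R M) :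
    ExteriorAlgebra.map (LinearMap.id - d.smulRight v) e =
      e - ExteriorAlgebra.ι R v * contractLeft (Q := 0) d e := by
  induction e using CliffordAlgebra.left_induction with
  | algebraMap r =>
    rw [AlgHom.commutes, CliffordAlgebra.contractLeft_algebraMap, mul_zero, sub_zero]
  | add a b ha hb => rw [map_add, ha, hb, map_add, mul_add]; abel
  | ι_mul a w ha =>
    have map_ι : ExteriorAlgebra.map (LinearMap.id - d.smulRight v) (CliffordAlgebra.ι 0 w) =
        ExteriorAlgebra.ι R w - d w • ExteriorAlgebra.ι R v :=
      (ExteriorAlgebra.map_apply_ι _ _).trans (by simp)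
    have swap : ExteriorAlgebra.ι R v * CliffordAlgebra.ι 0 w =
        -(CliffordAlgebra.ι 0 w * ExteriorAlgebra.ι R v) :=
      eq_neg_of_add_eq_zero_left (ExteriorAlgebra.ι_add_mul_swap v w)
    rw [map_mul, map_ι, ha, CliffordAlgebra.contractLeft_ι_mul]
    simp only [sub_mul, mul_sub, smul_mul_assoc, mul_smul_comm, ← mul_assoc, swap,
      ExteriorAlgebra.ι_sq_zero, zero_mul, smul_zero, neg_mul]
    abel

theorem exteriorAlgebra_map_zero (e : ExteriorAlgebra R M) :
    ExteriorAlgebra.map (0 : M →ₗ[R] M) e = ExteriorAlgebra.algebraMapInv e • 1 := by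
  have h : ExteriorAlgebra.map (0 : M →ₗ[R] M) =
      (Algebra.ofId R _).comp ExteriorAlgebra.algebraMapInv := by
    ext v
    simp [ExteriorAlgebra.algebraMapInv]
  rw [h, ← Algebra.algebraMap_eq_smul_one]
  rfl

theorem algebraMapInv_map (g : M →ₗ[R] N) (e : ExteriorAlgebra R M) :
    ExteriorAlgebra.algebraMapInv (ExteriorAlgebra.map g e) = ExteriorAlgebra.algebraMapInv e := by
  have h : ExteriorAlgebra.algebraMapInv.comp (ExteriorAlgebra.map g) =
      (ExteriorAlgebra.algebraMapInv : ExteriorAlgebra R M →ₐ[R] R) := by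
    ext v
    simp [ExteriorAlgebra.algebraMapInv]
  exact DFunLike.congr_fun h e

theorem map_mem_exteriorPower (g : M →ₗ[R] N) {k : ℕ} {e : ExteriorAlgebra R M}
    (he : e ∈ ⋀[R]^k M) : ExteriorAlgebra.map g e ∈ ⋀[R]^k N := by
  have h : (⋀[R]^k M).map (ExteriorAlgebra.map g).toLinearMap ≤ ⋀[R]^k N := by
    rw [ExteriorAlgebra.exteriorPower, Submodule.map_pow]
    refine pow_le_pow_left₀ zero_le ?_ k
    rintro _ ⟨_, ⟨v, rfl⟩, rfl⟩
    exact ⟨g v, (ExteriorAlgebra.map_apply_ι g v).symm⟩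
  exact h ⟨e, he, rfl⟩

theorem contractLeft_mem_exteriorPower (d : Module.Dual R M) {k : ℕ} {e : ExteriorAlgebra R M}
    (he : e ∈ ⋀[R]^(k + 1) M) : contractLeft (Q := 0) d e ∈ ⋀[R]^k M := by
  induction k generalizing e with
  | zero =>
    rw [ExteriorAlgebra.exteriorPower, zero_add, pow_one] at he
    obtain ⟨v, rfl⟩ := he
    rw [ExteriorAlgebra.exteriorPower, pow_zero]
    exact Submodule.mem_one.2 ⟨d v, (CliffordAlgebra.contractLeft_ι 0 d v).symm⟩
  | succ k ih =>
    rw [ExteriorAlgebra.exteriorPower, pow_succ'] at he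
    refine Submodule.mul_induction_on he ?_ fun a b ha hb => by rw [map_add]; exact add_mem ha hb
    rintro _ ⟨v, rfl⟩ a ha
    have leibniz : contractLeft (Q := 0) d (ExteriorAlgebra.ι R v * a) =
        d v • a - ExteriorAlgebra.ι R v * contractLeft (Q := 0) d a :=
      CliffordAlgebra.contractLeft_ι_mul d v a
    rw [leibniz]
    refine sub_mem (Submodule.smul_mem _ _ ha) ?_
    rw [ExteriorAlgebra.exteriorPower, pow_succ']
    exact Submodule.mul_mem_mul ⟨v, rfl⟩ (ih ha)

theorem contractLeft_eq_zero_of_mem_exteriorPower_zero (d : Module.Dual R M)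
    {e : ExteriorAlgebra R M} (he : e ∈ ⋀[R]^0 M) : contractLeft (Q := 0) d e = 0 := by
  rw [ExteriorAlgebra.exteriorPower, pow_zero] at he
  obtain ⟨r, rfl⟩ := Submodule.mem_one.1 he
  exact CliffordAlgebra.contractLeft_algebraMap 0 d r

theorem algebraMapInv_eq_zero_of_mem_exteriorPower_succ {k : ℕ} {e : ExteriorAlgebra R M}
    (he : e ∈ ⋀[R]^(k + 1) M) : ExteriorAlgebra.algebraMapInv e = 0 := by
  rw [ExteriorAlgebra.exteriorPower, pow_succ'] at he
  refine Submodule.mul_induction_on he ?_ fun a b ha hb => by rw [map_add, ha, hb, add_zero]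
  rintro _ ⟨v, rfl⟩ a _
  rw [map_mul]
  simp [ExteriorAlgebra.algebraMapInv]

theorem algebraMapInv_prod_contractLeft_eq_zero (L : List (Module.Dual R M)) {k : ℕ}
    {e : ExteriorAlgebra R M} (he : e ∈ ⋀[R]^k M) (hk : L.length ≠ k) :
    ExteriorAlgebra.algebraMapInv
      ((L.map fun d => (contractLeft (Q := 0) d : Module.End R (ExteriorAlgebra R M))).prod e)
      = 0 := by
  induction L using List.reverseRecOn generalizing k e with
  | nil =>
    obtain ⟨k, rfl⟩ := Nat.exists_eq_succ_of_ne_zero hk.symm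
    exact algebraMapInv_eq_zero_of_mem_exteriorPower_succ he
  | append_singleton L d ih =>
    rw [List.map_append, List.prod_append, List.map_singleton, List.prod_singleton,
      Module.End.mul_apply]
    cases k with
    | zero => rw [contractLeft_eq_zero_of_mem_exteriorPower_zero d he, map_zero, map_zero]
    | succ k =>
      refine ih (contractLeft_mem_exteriorPower d he) fun h => hk ?_
      rw [List.length_append, h, List.length_singleton]

end ExteriorAlgebra

variable {p n : ℕ}

/-! ### Coefficients with respect to the exterior variables -/

theorem tensor_ext {M : Type*} [AddCommMonoid M] {a b : H p n →+ M}
    (h : ∀ e f, a (tensor e f) = b (tensor e f)) : a = b := by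
  refine AddMonoidHom.ext fun z => ?_
  induction z using tensor_induction with
  | zero => simp only [map_zero]
  | tensor e f => exact h e f
  | add x y hx hy => simp only [map_add, hx, hy]

instance : Algebra (P p n) (H p n) :=
  Algebra.TensorProduct.rightAlgebra (R := ZMod p) (A := E p n) (B := P p n)

instance : IsScalarTower (ZMod p) (P p n) (H p n) :=
  Algebra.TensorProduct.right_isScalarTower (R := ZMod p) (A := E p n) (B := P p n)

theorem algebraMap_apply (q : P p n) : algebraMap (P p n) (H p n) q = tensor 1 q := rfl

theorem smul_tensor (q : P p n) (e : E p n) (f : P p n) : q • tensor e f = tensor e (q * f) := by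
  rw [Algebra.smul_def, algebraMap_apply]
  exact (Algebra.TensorProduct.tmul_mul_tmul _ _ _ _).trans (by rw [one_mul]; rfl)

/-- A linear map from `E ⊗ P` as a `P`-linear map, given that it is `P`-linear on pure tensors. -/
def polyLinear {M : Type*} [AddCommGroup M] [Module (ZMod p) M] [Module (P p n) M]
    (a : H p n →ₗ[ZMod p] M) (h : ∀ q e f, a (tensor e (q * f)) = q • a (tensor e f)) :
    H p n →ₗ[P p n] M where
  __ := a
  map_smul' q := DFunLike.congr_fun <| show
    a.toAddMonoidHom.comp (DistribSMul.toAddMonoidHom _ q) =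
      (DistribSMul.toAddMonoidHom _ q).comp a.toAddMonoidHom from
    tensor_ext fun e f => (congrArg a (smul_tensor q e f)).trans (h q e f)

/-- The `P`-linear extension `a ⊗ id` to `E ⊗ P` of an endomorphism `a` of `E`. -/
def extendScalars : Module.End (ZMod p) (E p n) →ₐ[ZMod p] Module.End (P p n) (H p n) where
  toFun a := polyLinear (tensorMap a LinearMap.id) fun q e f => (smul_tensor q (a e) f).symm
  map_one' := LinearMap.ext fun z => LinearMap.congr_fun TensorProduct.map_id z
  map_mul' a b := LinearMap.ext fun z =>
    LinearMap.congr_fun (TensorProduct.map_comp a LinearMap.id b LinearMap.id) z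
  map_zero' := LinearMap.ext fun z => LinearMap.congr_fun (TensorProduct.map_zero_left _) z
  map_add' a b := LinearMap.ext fun z => LinearMap.congr_fun (TensorProduct.map_add_left a b _) z
  commutes' c := LinearMap.ext fun z =>
    (LinearMap.congr_fun (TensorProduct.map_smul_left c LinearMap.id LinearMap.id) z).trans
      (congrArg (c • ·) (LinearMap.congr_fun TensorProduct.map_id z))

theorem extendScalars_tensor (a : Module.End (ZMod p) (E p n)) (e : E p n) (f : P p n) :
    extendScalars a (tensor e f) = tensor (a e) f := rfl

/-- The antiderivation `∂/∂xᵢ` of `E ⊗ P`. -/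
def pderivX (i : Fin n) : Module.End (P p n) (H p n) := extendScalars (partialX i)

/-- The iterated derivative of `E ⊗ P` with respect to a list of exterior variables. -/
def pderivList (S : List (Fin n)) : Module.End (P p n) (H p n) := (S.map pderivX).prod

/-- The projection of `E ⊗ P` onto `P` that sends the exterior variables to `0`. -/
def polyPart : H p n →ₗ[P p n] P p n :=
  polyLinear ((TensorProduct.lid (ZMod p) (P p n)).toLinearMap ∘ₗ
    TensorProduct.map
      (ExteriorAlgebra.algebraMapInv (R := ZMod p) (M := Fin n → ZMod p)).toLinearMap
      LinearMap.id) fun q e f => (mul_smul_comm (ExteriorAlgebra.algebraMapInv e) q f).symm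

/-- The coefficient at the product of a list of exterior variables, up to sign. -/
def coeffX (S : List (Fin n)) : H p n →ₗ[P p n] P p n := polyPart ∘ₗ pderivList S

theorem pderivX_tensor (i : Fin n) (e : E p n) (f : P p n) :
    pderivX i (tensor e f) = tensor (partialX i e) f := rfl

theorem polyPart_tensor (e : E p n) (f : P p n) :
    polyPart (tensor e f) = ExteriorAlgebra.algebraMapInv e • f := rfl

theorem pderivList_cons (s : Fin n) (S : List (Fin n)) (z : H p n) :
    pderivList (s :: S) z = pderivX s (pderivList S z) := rfl

theorem coeffX_apply (S : List (Fin n)) (z : H p n) : coeffX S z = polyPart (pderivList S z) := rfl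

theorem coeffX_tensor (S : List (Fin n)) (e : E p n) (f : P p n) :
    coeffX S (tensor e f) = ExteriorAlgebra.algebraMapInv ((S.map partialX).prod e) • f := by
  have h : (pderivList S : Module.End (P p n) (H p n)) =
      extendScalars ((S.map partialX).prod) := by
    rw [map_list_prod, List.map_map]
    rfl
  rw [coeffX_apply, h, extendScalars_tensor, polyPart_tensor]

theorem polyPart_algebraMap (q : P p n) : polyPart (algebraMap (P p n) (H p n) q) = q := by
  rw [algebraMap_apply, polyPart_tensor, map_one, one_smul]

theorem pderivX_pderivX (i : Fin n) (z : H p n) : pderivX i (pderivX i z) = 0 := by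
  have h : (partialX i * partialX i : Module.End (ZMod p) (E p n)) = 0 :=
    LinearMap.ext fun e => CliffordAlgebra.contractLeft_contractLeft _ e
  rw [pderivX, ← Module.End.mul_apply, ← map_mul, h, map_zero, LinearMap.zero_apply]

theorem pderivX_comm (i j : Fin n) (z : H p n) :
    pderivX i (pderivX j z) = -pderivX j (pderivX i z) := by
  have h : (partialX i * partialX j : Module.End (ZMod p) (E p n)) = -(partialX j * partialX i) :=
    LinearMap.ext fun e => CliffordAlgebra.contractLeft_comm _ _ e
  rw [pderivX, pderivX, ← Module.End.mul_apply, ← map_mul, h, map_neg, map_mul]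
  rfl

theorem pderivX_pderivList_of_mem {k : Fin n} {S : List (Fin n)} (hk : k ∈ S) (z : H p n) :
    pderivX k (pderivList S z) = 0 := by
  induction S with
  | nil => simp at hk
  | cons s S ih =>
    rw [pderivList_cons]
    by_cases h : k = s
    · rw [h, pderivX_pderivX]
    · rw [pderivX_comm, ih ((List.mem_cons.1 hk).resolve_left h), map_zero, neg_zero]

theorem nodup_of_pderivList_ne_zero {S : List (Fin n)} {z : H p n} (h : pderivList S z ≠ 0) :
    S.Nodup := by
  induction S with
  | nil => exact List.nodup_nil
  | cons s S ih =>
    rw [pderivList_cons] at h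
    exact List.nodup_cons.2 ⟨fun hs => h (pderivX_pderivList_of_mem hs z),
      ih fun h0 => h (by rw [h0, map_zero])⟩

theorem pderivList_eq_zero_of_lt_length {S : List (Fin n)} (hS : n < S.length) (z : H p n) :
    pderivList S z = 0 := by
  by_contra h0
  have hle := (nodup_of_pderivList_ne_zero h0).length_le_card
  rw [Fintype.card_fin] at hle
  omega

theorem nodup_of_coeffX_ne_zero {S : List (Fin n)} {z : H p n} (h : coeffX S z ≠ 0) : S.Nodup :=
  nodup_of_pderivList_ne_zero (z := z) fun h0 => h (by rw [coeffX_apply, h0, map_zero])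

theorem pderivList_eq_or_eq_neg_of_perm {S S' : List (Fin n)} (h : S.Perm S') (z : H p n) :
    pderivList S z = pderivList S' z ∨ pderivList S z = -pderivList S' z := by
  induction h with
  | nil => exact Or.inl rfl
  | cons s _ ih =>
    simp only [pderivList_cons]
    exact ih.imp (congrArg _) fun h => by rw [h, map_neg]
  | swap s t S => exact Or.inr (pderivX_comm _ _ _)
  | trans _ _ ih ih' => rcases ih with h | h <;> rcases ih' with h' | h' <;> simp [h, h']

theorem coeffX_eq_zero_of_perm {S S' : List (Fin n)} (h : S.Perm S') {z : H p n}
    (hz : coeffX S z = 0) : coeffX S' z = 0 := by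
  rw [coeffX_apply] at hz ⊢
  rcases pderivList_eq_or_eq_neg_of_perm h z with h | h
  · rwa [← h]
  · rwa [h, map_neg, neg_eq_zero] at hz

/-- The linear map that replaces the coordinates in `s` by `0`. -/
def zeroCoords (p : ℕ) (s : Finset (Fin n)) : (Fin n → ZMod p) →ₗ[ZMod p] (Fin n → ZMod p) :=
  LinearMap.pi fun j => if j ∈ s then 0 else LinearMap.proj j

theorem zeroCoords_empty : zeroCoords p (∅ : Finset (Fin n)) = LinearMap.id :=
  LinearMap.ext fun v => funext fun j => by simp [zeroCoords]

theorem zeroCoords_univ : zeroCoords p (Finset.univ : Finset (Fin n)) = 0 :=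
  LinearMap.ext fun v => funext fun j => by simp [zeroCoords]

theorem zeroCoords_insert (i : Fin n) (s : Finset (Fin n)) :
    zeroCoords p (insert i s) = zeroCoords p s ∘ₗ
      (LinearMap.id - (LinearMap.proj i : Module.Dual (ZMod p) (Fin n → ZMod p)).smulRight
        (Pi.single i 1)) := by
  refine LinearMap.ext fun v => funext fun j => ?_
  rcases eq_or_ne j i with rfl | hj
  · by_cases hs : j ∈ s <;> simp [zeroCoords, hs]
  · by_cases hs : j ∈ s <;> simp [zeroCoords, hs, hj]

theorem extendScalars_map_zeroCoords {z : H p n} (h : ∀ i, pderivX i z = 0)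
    (s : Finset (Fin n)) :
    extendScalars (ExteriorAlgebra.map (zeroCoords p s)).toLinearMap z = z := by
  induction s using Finset.induction_on with
  | empty =>
    rw [zeroCoords_empty, ExteriorAlgebra.map_id]
    exact LinearMap.congr_fun (map_one extendScalars) z
  | insert i s _ ih =>
    have factor : (ExteriorAlgebra.map (zeroCoords p (insert i s))).toLinearMap =
        (ExteriorAlgebra.map (zeroCoords p s)).toLinearMap *
          (1 - LinearMap.mulLeft (ZMod p) (ExteriorAlgebra.ι (ZMod p) (Pi.single i 1)) *
            partialX i) := by
      refine LinearMap.ext fun e => ?_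
      rw [zeroCoords_insert, ← ExteriorAlgebra.map_comp_map]
      exact congrArg _ (exteriorAlgebra_map_id_sub_smulRight _ _ e)
    have hi : extendScalars (partialX i) z = 0 := h i
    rw [factor, map_mul, map_sub, map_mul, map_one, Module.End.mul_apply, LinearMap.sub_apply,
      Module.End.mul_apply, hi, map_zero, sub_zero, Module.End.one_apply, ih]

theorem eq_algebraMap_polyPart {z : H p n} (h : ∀ i, pderivX i z = 0) :
    z = algebraMap (P p n) (H p n) (polyPart z) := by
  have key : (extendScalars (ExteriorAlgebra.map 0).toLinearMap).toAddMonoidHom =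
      (algebraMap (P p n) (H p n)).toAddMonoidHom.comp polyPart.toAddMonoidHom := by
    refine tensor_ext fun e f => ?_
    change tensor (ExteriorAlgebra.map 0 e) f = tensor 1 (ExteriorAlgebra.algebraMapInv e • f)
    rw [exteriorAlgebra_map_zero, tensor_smul_comm]
  calc z = extendScalars (ExteriorAlgebra.map (zeroCoords p Finset.univ)).toLinearMap z :=
        (extendScalars_map_zeroCoords h _).symm
    _ = algebraMap (P p n) (H p n) (polyPart z) := by
        rw [zeroCoords_univ]
        exact DFunLike.congr_fun key z

theorem eq_zero_of_coeffX_eq_zero {z : H p n} (h : ∀ S, coeffX S z = 0) : z = 0 := by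
  have key (m : ℕ) : ∀ S : List (Fin n), n + 1 ≤ S.length + m → pderivList S z = 0 := by
    induction m with
    | zero => exact fun S hS => pderivList_eq_zero_of_lt_length hS z
    | succ m ih =>
      intro S hS
      have hS' : ∀ i, pderivX i (pderivList S z) = 0 := fun i =>
        ih (i :: S) (by rw [List.length_cons]; omega)
      rw [eq_algebraMap_polyPart hS', ← coeffX_apply, h S, map_zero]
  exact key (n + 1) [] (by simp)

theorem pi_coeffX_injective : Function.Injective (LinearMap.pi (coeffX (p := p) (n := n))) :=
  (injective_iff_map_eq_zero _).2 fun _ h => eq_zero_of_coeffX_eq_zero fun S => congrFun h S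

instance [Fact p.Prime] : Module.IsTorsionFree (P p n) (H p n) :=
  Function.Injective.moduleIsTorsionFree _ pi_coeffX_injective (map_smul _)

theorem pderivX_act (g : Matrix (Fin n) (Fin n) (ZMod p)) (i : Fin n) (z : H p n) :
    pderivX i (act g z) = ∑ j, g i j • act g (pderivX j z) := by
  induction z using tensor_induction with
  | zero => simp only [map_zero, smul_zero, Finset.sum_const_zero]
  | tensor e f =>
    simp only [act_tensor, pderivX_tensor, partialX_map, tensor_sum_left]
    rfl
  | add a b ha hb => simp only [map_add, ha, hb, smul_add, Finset.sum_add_distrib]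

theorem polyPart_act (g : Matrix (Fin n) (Fin n) (ZMod p)) (z : H p n) :
    polyPart (act g z) = polyAct g (polyPart z) := by
  induction z using tensor_induction with
  | zero => simp only [map_zero]
  | tensor e f => rw [act_tensor, polyPart_tensor, polyPart_tensor, map_smul, algebraMapInv_map]
  | add a b ha hb => simp only [map_add, ha, hb]

/-! ### The grading -/

/-- The polynomials of degree `j` with `l + 2 j = k`: the possible coefficients at a product of `l`
exterior variables in an element of degree `k`. -/
def coeffDegree (p n l k : ℕ) : Submodule (ZMod p) (P p n) :=
  restrictSupport (ZMod p) {m | l + 2 * m.degree = k}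

theorem mem_coeffDegree_of_isHomogeneous {l j k : ℕ} (h : l + 2 * j = k) {f : P p n}
    (hf : f.IsHomogeneous j) : f ∈ coeffDegree p n l k := by
  refine (mem_restrictSupport_iff _).2 fun m hm => ?_
  by_contra hdeg
  exact mem_support_iff.1 hm (hf.coeff_eq_zero fun hj => hdeg (by rw [← hj] at h; exact h))

theorem exists_isHomogeneous_of_mem_coeffDegree {l k : ℕ} {f : P p n}
    (hf : f ∈ coeffDegree p n l k) (h0 : f ≠ 0) : ∃ j, l + 2 * j = k ∧ f.IsHomogeneous j := by
  have hdeg : ∀ m ∈ f.support, l + 2 * m.degree = k := (mem_restrictSupport_iff _).1 hf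
  obtain ⟨m, hm⟩ := support_nonempty.2 h0
  refine ⟨m.degree, hdeg m hm, fun m' hm' => ?_⟩
  have := hdeg m hm
  have := hdeg m' (mem_support_iff.2 hm')
  exact (DFunLike.congr_fun Finsupp.degree_eq_weight_one m').symm.trans (by omega)

theorem coeffDegree_finite [Fact p.Prime] (l k : ℕ) :
    (coeffDegree p n l k : Set (P p n)).Finite := by
  have : Finite {m : Fin n →₀ ℕ | l + 2 * m.degree = k} :=
    (Finsupp.finite_of_degree_le k).subset fun m (hm : _ = k) => show m.degree ≤ k by omega
  have : Module.Finite (ZMod p) (coeffDegree p n l k) :=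
    Module.Finite.of_basis (basisRestrictSupport (ZMod p) _)
  exact Set.finite_coe_iff.1 (Module.finite_of_finite (ZMod p))

theorem degreePart_le {k : ℕ} {N : Submodule (ZMod p) (H p n)}
    (h : ∀ (i j : ℕ) (e : E p n) (f : P p n), i + 2 * j = k →
      e ∈ (⋀[ZMod p]^i (Fin n → ZMod p)) → f.IsHomogeneous j → tensor e f ∈ N) :
    degreePart p n k ≤ N := by
  refine Submodule.span_le.2 ?_
  rintro _ ⟨i, j, e, f, hk, he, hf, rfl⟩
  exact h i j e f hk he hf

theorem tensor_mem_degreePart {i j k : ℕ} {e : E p n} {f : P p n} (hk : i + 2 * j = k)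
    (he : e ∈ (⋀[ZMod p]^i (Fin n → ZMod p))) (hf : f.IsHomogeneous j) :
    tensor e f ∈ degreePart p n k :=
  Submodule.subset_span ⟨i, j, e, f, hk, he, hf, rfl⟩

theorem coeffX_mem_coeffDegree (S : List (Fin n)) {k : ℕ} {z : H p n}
    (hz : z ∈ degreePart p n k) : coeffX S z ∈ coeffDegree p n S.length k := by
  refine degreePart_le
    (N := (coeffDegree p n S.length k).comap ((coeffX S).restrictScalars (ZMod p))) ?_ hz
  intro i j e f hk he hf
  rw [Submodule.mem_comap, LinearMap.restrictScalars_apply, coeffX_tensor]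
  by_cases hi : S.length = i
  · exact Submodule.smul_mem _ _ (mem_coeffDegree_of_isHomogeneous (by rw [hi, hk]) hf)
  · have h0 : ExteriorAlgebra.algebraMapInv ((S.map partialX).prod e) = 0 := by
      have := algebraMapInv_prod_contractLeft_eq_zero (S.map LinearMap.proj) he
        (by rwa [List.length_map])
      rwa [List.map_map] at this
    rw [h0, zero_smul]
    exact zero_mem _

theorem exists_coeffX_ne_zero {k : ℕ} {z : H p n} (hz : z ∈ degreePart p n k) (h0 : z ≠ 0) :
    ∃ (S : List (Fin n)) (j : ℕ), S.length + 2 * j = k ∧ coeffX S z ≠ 0 ∧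
      (coeffX S z).IsHomogeneous j := by
  obtain ⟨S, hS⟩ : ∃ S, coeffX S z ≠ 0 := by
    by_contra! h
    exact h0 (eq_zero_of_coeffX_eq_zero h)
  obtain ⟨j, hj, hh⟩ := exists_isHomogeneous_of_mem_coeffDegree (coeffX_mem_coeffDegree S hz) hS
  exact ⟨S, j, hj, hS, hh⟩

theorem tensor_zero_left (f : P p n) : tensor (0 : E p n) f = 0 := TensorProduct.zero_tmul _ _

theorem pderivX_mem_degreePart (i : Fin n) {k : ℕ} {z : H p n}
    (hz : z ∈ degreePart p n (k + 1)) : pderivX i z ∈ degreePart p n k := by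
  refine degreePart_le
    (N := (degreePart p n k).comap ((pderivX i).restrictScalars (ZMod p))) ?_ hz
  intro l j e f hk he hf
  change tensor (partialX i e) f ∈ degreePart p n k
  cases l with
  | zero =>
    rw [partialX, contractLeft_eq_zero_of_mem_exteriorPower_zero _ he, tensor_zero_left]
    exact zero_mem _
  | succ l => exact tensor_mem_degreePart (by omega) (contractLeft_mem_exteriorPower _ he) hf

theorem polyAct_isHomogeneous (g : Matrix (Fin n) (Fin n) (ZMod p)) {f : P p n} {j : ℕ}
    (hf : f.IsHomogeneous j) : (polyAct g f).IsHomogeneous j := by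
  rw [← one_mul j]
  refine hf.aeval _ fun j => IsHomogeneous.sum _ _ _ fun i _ => ?_
  rw [smul_eq_C_mul]
  exact (isHomogeneous_X _ _).C_mul _

theorem act_mem_degreePart (g : Matrix (Fin n) (Fin n) (ZMod p)) {k : ℕ} {z : H p n}
    (hz : z ∈ degreePart p n k) : act g z ∈ degreePart p n k := by
  refine degreePart_le (N := (degreePart p n k).comap (act g).toLinearMap) ?_ hz
  intro i j e f hk he hf
  exact tensor_mem_degreePart hk (map_mem_exteriorPower _ he) (polyAct_isHomogeneous g hf)

theorem iSup_degreePart : ⨆ k, degreePart p n k = ⊤ := by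
  refine eq_top_iff.2 fun z _ => ?_
  induction z using tensor_induction with
  | zero => exact zero_mem _
  | tensor e f =>
    let tensorRight : E p n →ₗ[ZMod p] H p n :=
      (TensorProduct.mk (ZMod p) (E p n) (P p n)).flip f
    have hE : ⨆ i : ℕ, ⋀[ZMod p]^i (Fin n → ZMod p) = ⊤ :=
      (DirectSum.Decomposition.isInternal _).submodule_iSup_eq_top
    suffices h : ⨆ i : ℕ, ⋀[ZMod p]^i (Fin n → ZMod p) ≤
        (⨆ k, degreePart p n k).comap tensorRight from h (hE ▸ Submodule.mem_top)
    refine iSup_le fun i e he => ?_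
    change tensor e f ∈ ⨆ k, degreePart p n k
    rw [← sum_homogeneousComponent f, tensor_sum_right]
    exact sum_mem fun j _ => Submodule.mem_iSup_of_mem (i + 2 * j)
      (tensor_mem_degreePart rfl he (homogeneousComponent_isHomogeneous _ _))
  | add a b ha hb => exact add_mem (ha trivial) (hb trivial)

theorem iSupIndep_of_separating_family {ι J R M N : Type*} [Ring R] [AddCommGroup M] [Module R M]
    [AddCommGroup N] [Module R N] {A : ι → Submodule R M} (φ : J → M →ₗ[R] N) (d : J → ι)
    (hφ : ∀ z, (∀ j, φ j z = 0) → z = 0) (hA : ∀ j k, k ≠ d j → A k ≤ LinearMap.ker (φ j)) :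
    iSupIndep A := by
  refine fun i => Submodule.disjoint_def.2 fun z hzi hz => hφ z fun j => ?_
  rcases eq_or_ne i (d j) with rfl | hj
  · exact iSup₂_le (hA j) hz
  · exact hA j i hj hzi

theorem iSupIndep_degreePart : iSupIndep (degreePart p n) := by
  refine iSupIndep_of_separating_family (J := List (Fin n) × (Fin n →₀ ℕ))
    (fun Sm => lcoeff (ZMod p) Sm.2 ∘ₗ (coeffX Sm.1).restrictScalars (ZMod p))
    (fun Sm => Sm.1.length + 2 * Sm.2.degree) (fun z hz => ?_) fun ⟨S, m⟩ k hk z hz => ?_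
  · exact eq_zero_of_coeffX_eq_zero fun S => MvPolynomial.ext _ _ fun m => hz (S, m)
  · by_contra h
    exact hk ((mem_restrictSupport_iff _).1 (coeffX_mem_coeffDegree S hz)
      (mem_support_iff.2 h)).symm

theorem degreePart_finite [Fact p.Prime] (k : ℕ) : (degreePart p n k : Set (H p n)).Finite := by
  have : Finite {S : List (Fin n) // S.Nodup} := inferInstance
  have hfin : (Set.pi Set.univ fun S : {S : List (Fin n) // S.Nodup} =>
      (coeffDegree p n S.1.length k : Set (P p n))).Finite :=
    Set.Finite.pi fun S => coeffDegree_finite _ _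
  refine Set.Finite.of_finite_image (hfin.subset ?_)
    (f := fun z (S : {S : List (Fin n) // S.Nodup}) => coeffX S.1 z) ?_
  · rintro _ ⟨z, hz, rfl⟩ S _
    exact coeffX_mem_coeffDegree _ hz
  · refine fun z _ z' _ h => pi_coeffX_injective (funext fun S => ?_)
    by_cases hS : S.Nodup
    · exact congrFun h ⟨S, hS⟩
    · have hS' (w : H p n) : coeffX S w = 0 := not_not.1 (mt nodup_of_coeffX_ne_zero hS)
      rw [LinearMap.pi_apply, LinearMap.pi_apply, hS', hS']

theorem exists_eq_smul_one_of_mem_degreePart_zero {z : H p n} (hz : z ∈ degreePart p n 0) :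
    ∃ c : ZMod p, z = c • 1 := by
  refine (Submodule.mem_span_singleton.1 (degreePart_le
    (N := Submodule.span (ZMod p) {1}) ?_ hz)).imp fun _ => Eq.symm
  intro i j e f hk he hf
  obtain ⟨rfl, rfl⟩ : i = 0 ∧ j = 0 := by omega
  rw [ExteriorAlgebra.exteriorPower, pow_zero] at he
  obtain ⟨r, rfl⟩ := Submodule.mem_one.1 he
  obtain ⟨c, rfl⟩ : ∃ c, f = C c :=
    ⟨_, totalDegree_eq_zero_iff_eq_C.1 (Nat.le_zero.1 hf.totalDegree_le)⟩
  refine Submodule.mem_span_singleton.2 ⟨r * c, ?_⟩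
  rw [mul_smul, Algebra.algebraMap_eq_smul_one, ← mul_one (C c), ← smul_eq_C_mul]
  exact congrArg (r • ·) (TensorProduct.tmul_smul c (1 : E p n) (1 : P p n)).symm

instance : IsScalarTower (ZMod p) (SteenrodAlgebra p) (H p n) where
  smul_assoc c a z := by
    rw [smul_eq_steenrodAct, map_smul]
    rfl

section Invariants

variable [Fact p.Prime]

theorem mem_D {z : H p n} : z ∈ D p n ↔
    ∀ g : GL (Fin n) (ZMod p), act (g : Matrix (Fin n) (Fin n) (ZMod p)) z = z :=
  mem_dicksonSubalgebra

theorem DDegree_finite (k : ℕ) : (DDegree p n k : Set (D p n)).Finite :=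
  Set.Finite.preimage (f := fun z : D p n => (z : H p n)) Subtype.val_injective.injOn
    (degreePart_finite k)

theorem iSupIndep_DDegree : iSupIndep fun k => DDegree p n k := by
  refine fun k => AddSubgroup.disjoint_def.2 fun {z} hzk hz => Subtype.ext ?_
  have h : ⨆ j, ⨆ _ : j ≠ k, DDegree p n j ≤
      (⨆ j, ⨆ _ : j ≠ k, degreePart p n j).toAddSubgroup.comap (D p n).subtype.toAddMonoidHom :=
    iSup₂_le fun j hj w hw => le_iSup₂ (f := fun j _ => degreePart p n j) j hj hw
  exact Submodule.disjoint_def.1 (iSupIndep_degreePart k) (z : H p n) hzk (h hz)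

theorem iSup_DDegree : ⨆ k, DDegree p n k = ⊤ := by
  refine eq_top_iff.2 fun z _ => ?_
  obtain ⟨w, hw, hz⟩ := (Submodule.mem_iSup_iff_exists_finsupp _ _).1
    (iSup_degreePart (p := p) (n := n) ▸ Submodule.mem_top : (z : H p n) ∈ ⨆ k, degreePart p n k)
  replace hz : ∑ k ∈ w.support, w k = z := hz
  have hwD : ∀ k ∈ w.support, w k ∈ D p n := fun k hk => mem_D.2 fun g => by
    have hsum : ∑ k ∈ w.support, (act g.1 (w k) - w k) = 0 := by
      rw [Finset.sum_sub_distrib, ← map_sum, hz, mem_D.1 z.2 g, sub_self]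
    exact sub_eq_zero.1 ((iSupIndep_iff_finsetSum_eq_zero_imp_eq_zero _).1 iSupIndep_degreePart
      _ _ (fun k _ => sub_mem (act_mem_degreePart _ (hw k)) (hw k)) hsum k hk)
  have hz' : z = ∑ k ∈ w.support.attach, ⟨w k, hwD k k.2⟩ := Subtype.ext <| by
    rw [← hz, ← Finset.sum_attach, AddSubmonoidClass.coe_finsetSum]
  rw [hz']
  exact sum_mem fun k _ => AddSubgroup.mem_iSup_of_mem k.1 (hw k)

theorem exists_eq_smul_one_of_mem_DDegree_zero {z : D p n} (hz : z ∈ DDegree p n 0) :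
    ∃ c : ZMod p, z = c • 1 :=
  (exists_eq_smul_one_of_mem_degreePart_zero hz).imp fun _ h => Subtype.ext h

end Invariants

/-! ### Moore determinants -/

/-- The matrix with entries `yⱼ ^ p ^ gᵢ`. -/
def mooreMatrix (p : ℕ) {n : ℕ} (g : Fin n → ℕ) : Matrix (Fin n) (Fin n) (P p n) :=
  Matrix.of fun i j => X j ^ p ^ g i

theorem prod_mooreMatrix (g : Fin n → ℕ) (σ : Equiv.Perm (Fin n)) :
    ∏ j, mooreMatrix p g (σ j) j =
      monomial (Finsupp.equivFunOnFinite.symm fun j => p ^ g (σ j)) 1 := by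
  rw [monomial_eq, Finsupp.prod_fintype _ _ fun _ => pow_zero _, map_one, one_mul]
  rfl

theorem mooreMatrix_det_ne_zero [Fact p.Prime] {g : Fin n → ℕ} (hg : Function.Injective g) :
    (mooreMatrix p g).det ≠ 0 := by
  classical
  suffices h : coeff (Finsupp.equivFunOnFinite.symm fun j => p ^ g j) (mooreMatrix p g).det = 1 by
    intro h0
    rw [h0, coeff_zero] at h
    exact zero_ne_one h
  rw [Matrix.det_apply, coeff_sum, Finset.sum_eq_single 1]
  · rw [prod_mooreMatrix, Equiv.Perm.sign_one, one_smul]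
    exact (coeff_monomial _ _ _).trans (if_pos rfl)
  · intro σ _ hσ
    rw [prod_mooreMatrix, Units.smul_def, coeff_smul, coeff_monomial, if_neg, smul_zero]
    exact fun h => hσ (Equiv.ext fun j => hg
      (Nat.pow_right_injective (Fact.out : p.Prime).two_le (DFunLike.congr_fun h j)))
  · exact fun h => absurd (Finset.mem_univ _) h

theorem mooreMatrix_det_isHomogeneous (g : Fin n → ℕ) :
    (mooreMatrix p g).det.IsHomogeneous (∑ i, p ^ g i) := by
  rw [Matrix.det_apply]
  refine IsHomogeneous.sum _ _ _ fun σ _ => ?_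
  rw [Units.smul_def, ← Int.cast_smul_eq_zsmul (ZMod p), smul_eq_C_mul, ← Equiv.sum_comp σ]
  exact (IsHomogeneous.prod _ _ _ fun j _ => isHomogeneous_X_pow _ _).C_mul _

/-! ### The Milnor primitives -/

theorem polyPower_apply (k : ℕ) (f : P p n) :
    polyPower p n k f = (totalPower p n f).coeff k := rfl

theorem polyPower_zero (f : P p n) : polyPower p n 0 f = f := by
  have h : ((Polynomial.aeval (0 : P p n)).restrictScalars (ZMod p)).comp (totalPower p n) =
      AlgHom.id (ZMod p) (P p n) :=
    algHom_ext fun j => by simp [totalPower]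
  rw [polyPower_apply, Polynomial.coeff_zero_eq_aeval_zero]
  exact DFunLike.congr_fun h f

theorem totalPower_X_pow [Fact p.Prime] (j : Fin n) (i : ℕ) :
    totalPower p n (X j ^ p ^ i) = Polynomial.C (X j ^ p ^ i) +
      Polynomial.C (X j ^ p ^ (i + 1)) * Polynomial.X ^ p ^ i := by
  rw [map_pow, totalPower, aeval_X, add_pow_char_pow, mul_pow, ← Polynomial.C_pow,
    ← Polynomial.C_pow, ← pow_mul, pow_succ' p i]

theorem polyPower_X_pow_mul [Fact p.Prime] (j : Fin n) (i : ℕ) (f : P p n) :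
    polyPower p n (p ^ i) (X j ^ p ^ i * f) =
      X j ^ p ^ i * polyPower p n (p ^ i) f + X j ^ p ^ (i + 1) * f := by
  rw [polyPower_apply, map_mul, totalPower_X_pow, add_mul, Polynomial.coeff_add,
    Polynomial.coeff_C_mul, mul_assoc, Polynomial.coeff_C_mul, mul_comm (Polynomial.X ^ _),
    Polynomial.coeff_mul_X_pow', if_pos le_rfl, Nat.sub_self, ← polyPower_apply, ← polyPower_apply,
    polyPower_zero]

/-- The Milnor primitive `Qᵢ`: the antiderivation with `xⱼ ↦ yⱼ ^ p ^ i` and `yⱼ ↦ 0`. -/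
def milnor (p n i : ℕ) : Module.End (P p n) (H p n) :=
  ∑ j : Fin n, (X j ^ p ^ i : P p n) • pderivX j

theorem milnor_apply (i : ℕ) (z : H p n) :
    milnor p n i z = ∑ j : Fin n, (X j ^ p ^ i : P p n) • pderivX j z := by
  rw [milnor, LinearMap.sum_apply]
  rfl

theorem milnor_tensor (i : ℕ) (e : E p n) (f : P p n) :
    milnor p n i (tensor e f) = ∑ j : Fin n, tensor (partialX j e) (X j ^ p ^ i * f) := by
  simp only [milnor_apply, pderivX_tensor, smul_tensor]

theorem milnor_zero (z : H p n) : milnor p n 0 z = bockstein p n z := by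
  induction z using tensor_induction with
  | zero => simp only [map_zero]
  | tensor e f => simp only [milnor_tensor, pow_zero, pow_one, bockstein_tensor]
  | add a b ha hb => simp only [map_add, ha, hb]

theorem milnor_succ [Fact p.Prime] (i : ℕ) (z : H p n) : milnor p n (i + 1) z =
    power p n (p ^ i) (milnor p n i z) - milnor p n i (power p n (p ^ i) z) := by
  induction z using tensor_induction with
  | zero => simp only [map_zero, sub_zero]
  | tensor e f =>
    have tensor_add (j : Fin n) (f f' : P p n) : tensor (partialX j e) (f + f') =
        tensor (partialX j e) f + tensor (partialX j e) f' := TensorProduct.tmul_add _ _ _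
    simp only [power_tensor, milnor_tensor, map_sum, polyPower_X_pow_mul, tensor_add,
      Finset.sum_add_distrib, add_sub_cancel_left]
  | add a b ha hb =>
    simp only [map_add, ha, hb]
    abel

theorem smul_mem_degreePart {q : P p n} {d k : ℕ} (hq : q.IsHomogeneous d) {z : H p n}
    (hz : z ∈ degreePart p n k) : q • z ∈ degreePart p n (k + 2 * d) := by
  refine degreePart_le (N := (degreePart p n (k + 2 * d)).comap
    ((LinearMap.lsmul (P p n) (H p n) q).restrictScalars (ZMod p))) ?_ hz
  intro i j e f hk he hf
  rw [Submodule.mem_comap, LinearMap.restrictScalars_apply, LinearMap.lsmul_apply, smul_tensor]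
  exact tensor_mem_degreePart (j := d + j) (by omega) he (hq.mul hf)

theorem milnor_mem_degreePart (i : ℕ) {k : ℕ} {z : H p n} (hz : z ∈ degreePart p n (k + 1)) :
    milnor p n i z ∈ degreePart p n (k + 2 * p ^ i) := by
  rw [milnor_apply]
  exact sum_mem fun j _ => smul_mem_degreePart (isHomogeneous_X_pow _ _)
    (pderivX_mem_degreePart j hz)

theorem det_smul_pderivX (z : H p n) (k : Fin n) :
    (mooreMatrix p fun i : Fin n => (i : ℕ)).det • pderivX k z =
      ∑ i : Fin n, (mooreMatrix p fun i : Fin n => (i : ℕ)).adjugate k i • milnor p n i z := by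
  set M := mooreMatrix p fun i : Fin n => (i : ℕ)
  calc M.det • pderivX k z = ∑ j, (M.adjugate * M) k j • pderivX j z := by
        simp only [Matrix.adjugate_mul, Matrix.smul_apply, Matrix.one_apply, smul_eq_mul, mul_ite,
          mul_one, mul_zero, ite_smul, zero_smul, Finset.sum_ite_eq, Finset.mem_univ, if_true]
    _ = ∑ i, M.adjugate k i • milnor p n i z := by
        simp only [Matrix.mul_apply, Finset.sum_smul, milnor_apply, Finset.smul_sum, mul_smul]
        exact Finset.sum_comm

theorem pderivX_eq_zero_of_milnor [Fact p.Prime] {z : H p n} (h : ∀ i, milnor p n i z = 0)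
    (k : Fin n) : pderivX k z = 0 := by
  refine (smul_eq_zero.1 (det_smul_pderivX z k |>.trans ?_)).resolve_left
    (mooreMatrix_det_ne_zero Fin.val_injective)
  simp only [h, smul_zero, Finset.sum_const_zero]

theorem pderivList_milnor (S : List (Fin n)) (i : ℕ) (z : H p n) :
    pderivList S (milnor p n i z) =
      ∑ j : Fin n, (X j ^ p ^ i : P p n) • pderivList (S ++ [j]) z := by
  simp only [milnor_apply, map_sum, map_smul, pderivList, List.map_append, List.prod_append,
    List.map_singleton, List.prod_singleton, Module.End.mul_apply]

/-- The Bockstein, as an element of the Steenrod algebra. -/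
def bocksteinElem (p : ℕ) : SteenrodAlgebra p :=
  ⟨fun m => bockstein p m, Algebra.subset_adjoin (Set.mem_insert _ _)⟩

/-- The reduced power `Pᵏ`, as an element of the Steenrod algebra. -/
def powerElem (p k : ℕ) : SteenrodAlgebra p :=
  ⟨fun m => power p m k, Algebra.subset_adjoin (Set.mem_insert_of_mem _ ⟨k, rfl⟩)⟩

theorem bocksteinElem_smul (z : H p n) : bocksteinElem p • z = bockstein p n z := rfl

theorem powerElem_smul (k : ℕ) (z : H p n) : powerElem p k • z = power p n k z := rfl

section SteenrodSubmodule

variable [Fact p.Prime] {N : Submodule (SteenrodAlgebra p) (H p n)}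

theorem milnor_mem (i : ℕ) {z : H p n} (hz : z ∈ N) : milnor p n i z ∈ N := by
  induction i generalizing z with
  | zero =>
    rw [milnor_zero, ← bocksteinElem_smul]
    exact N.smul_mem _ hz
  | succ i ih =>
    rw [milnor_succ, ← powerElem_smul, ← powerElem_smul]
    exact sub_mem (N.smul_mem _ (ih hz)) (ih (N.smul_mem _ hz))

theorem exists_eq_algebraMap_of_milnor_eq_zero {k : ℕ} {z : H p n} (hz : z ∈ degreePart p n k)
    (h0 : z ≠ 0) (h : ∀ i, milnor p n i z = 0) :
    ∃ (f : P p n) (j : ℕ), z = algebraMap (P p n) (H p n) f ∧ f ≠ 0 ∧ f.IsHomogeneous j ∧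
      k = 2 * j := by
  have hpoly := eq_algebraMap_polyPart (pderivX_eq_zero_of_milnor h)
  have hne : polyPart z ≠ 0 := fun h => h0 (by rw [hpoly, h, map_zero])
  obtain ⟨j, hj, hhom⟩ :=
    exists_isHomogeneous_of_mem_coeffDegree (coeffX_mem_coeffDegree [] hz) hne
  rw [List.length_nil] at hj
  exact ⟨polyPart z, j, hpoly, hne, hhom, by omega⟩

/-- Applying Milnor primitives lowers the number of exterior variables, so after finitely many of
them one reaches a nonzero element that they all kill, which by Cramer's rule is a polynomial. -/
theorem exists_algebraMap_mem {k : ℕ} (hk : 0 < k) {z : H p n} (hz : z ∈ degreePart p n k)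
    (hzN : z ∈ N) (h0 : z ≠ 0) :
    ∃ (h : P p n) (j : ℕ), algebraMap (P p n) (H p n) h ∈ N ∧ h ≠ 0 ∧ h.IsHomogeneous j ∧
      0 < j := by
  obtain ⟨m, hm⟩ : ∃ m, ∀ S : List (Fin n), S.length = m → pderivList S z = 0 :=
    ⟨n + 1, fun S hS => pderivList_eq_zero_of_lt_length (by omega) z⟩
  induction m generalizing k z with
  | zero => exact absurd (hm [] rfl) h0
  | succ m ih =>
    by_cases h : ∀ i, milnor p n i z = 0
    · obtain ⟨f, j, rfl, hf0, hf, hj⟩ := exists_eq_algebraMap_of_milnor_eq_zero hz h0 h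
      exact ⟨f, j, hzN, hf0, hf, by omega⟩
    · push Not at h
      obtain ⟨i, hi⟩ := h
      obtain ⟨k, rfl⟩ := Nat.exists_eq_succ_of_ne_zero hk.ne'
      have hpos : 0 < p ^ i := Nat.pow_pos (Fact.out : p.Prime).pos
      refine ih (by omega) (milnor_mem_degreePart i hz) (milnor_mem i hzN) hi fun S hS => ?_
      rw [pderivList_milnor]
      exact Finset.sum_eq_zero fun j _ => by
        rw [hm _ (by rw [List.length_append, hS, List.length_singleton]), smul_zero]

end SteenrodSubmodule

/-! ### Additive substitutions -/

section Homogeneous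

variable {R σ A : Type*} [CommSemiring R] [CommSemiring A] [Algebra R A] {q : MvPolynomial σ R}
  {d : ℕ}

theorem aeval_const_mul_of_isHomogeneous (hq : q.IsHomogeneous d) (c : A) (v : σ → A) :
    aeval (fun j => c * v j) q = c ^ d * aeval v q := by
  rw [aeval_def, aeval_def, eval₂_eq, eval₂_eq, Finset.mul_sum]
  refine Finset.sum_congr rfl fun m hm => ?_
  rw [hq.degree_eq_sum_deg_support hm, ← Finset.prod_pow_eq_pow_sum, mul_left_comm,
    ← Finset.prod_mul_distrib]
  simp only [mul_pow]

theorem aeval_zero_of_isHomogeneous (hq : q.IsHomogeneous d) (hd : 0 < d) :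
    aeval (0 : σ → A) q = 0 := by
  rw [aeval_zero, constantCoeff_eq, hq.coeff_eq_zero (by rw [map_zero]; exact hd.ne), map_zero]

end Homogeneous

/-- The extension of scalars to `A` of a linear functional on the polynomials over `R`. -/
def extFunctional {R σ : Type*} [CommRing R] (ℓ : MvPolynomial σ R →ₗ[R] R) (A : Type*)
    [CommRing A] [Algebra R A] : MvPolynomial σ A →ₗ[A] A :=
  (basisMonomials σ A).constr A fun m => algebraMap R A (ℓ (monomial m 1))

section ExtFunctional

variable {R σ : Type*} [CommRing R] (ℓ : MvPolynomial σ R →ₗ[R] R) {A B : Type*} [CommRing A]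
  [Algebra R A] [CommRing B] [Algebra R B]

theorem extFunctional_monomial (m : σ →₀ ℕ) (a : A) :
    extFunctional ℓ A (monomial m a) = a * algebraMap R A (ℓ (monomial m 1)) := by
  have h := (basisMonomials σ A).constr_basis A (fun m => algebraMap R A (ℓ (monomial m 1))) m
  rw [coe_basisMonomials] at h
  rw [← mul_one a, ← smul_eq_mul, ← smul_monomial, map_smul, smul_eq_mul, smul_eq_mul, mul_one]
  exact congrArg _ h

theorem extFunctional_map_algebraMap (q : MvPolynomial σ R) :
    extFunctional ℓ A (map (algebraMap R A) q) = algebraMap R A (ℓ q) := by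
  induction q using MvPolynomial.induction_on' with
  | monomial m a =>
    rw [map_monomial, extFunctional_monomial, ← map_mul, ← smul_eq_mul, ← map_smul, smul_monomial,
      smul_eq_mul, mul_one]
  | add f g hf hg => simp only [map_add, hf, hg]

theorem extFunctional_map (φ : A →ₐ[R] B) (q : MvPolynomial σ A) :
    extFunctional ℓ B (map (φ : A →+* B) q) = φ (extFunctional ℓ A q) := by
  induction q using MvPolynomial.induction_on' with
  | monomial m a =>
    rw [map_monomial, extFunctional_monomial, extFunctional_monomial, map_mul, AlgHom.commutes]
    rfl
  | add f g hf hg => simp only [map_add, hf, hg]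

end ExtFunctional

/-- The substitution `yⱼ ↦ ∑ₛ rₛ yⱼ ^ p ^ s`, where `s ≤ B`. -/
def addSubst (p n : ℕ) {A : Type*} [CommRing A] [Algebra (ZMod p) A] (B : ℕ) (r : ℕ → A) :
    P p n →ₐ[ZMod p] MvPolynomial (Fin n) A :=
  aeval fun j => ∑ s ∈ Finset.range (B + 1), C (r s) * X j ^ p ^ s

section AddSubst

variable {A A' : Type*} [CommRing A] [Algebra (ZMod p) A] [CommRing A'] [Algebra (ZMod p) A']

theorem addSubst_X (B : ℕ) (r : ℕ → A) (j : Fin n) :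
    addSubst p n B r (X j) = ∑ s ∈ Finset.range (B + 1), C (r s) * X j ^ p ^ s :=
  aeval_X _ _

theorem addSubst_zero {r : ℕ → A} (h : r 0 = 1) (z : P p n) :
    addSubst p n 0 r z = map (algebraMap (ZMod p) A) z := by
  have h : addSubst p n 0 r = mapAlgHom (Algebra.ofId (ZMod p) A) :=
    algHom_ext fun j => by
      rw [addSubst_X, Finset.sum_range_one, h, map_one, one_mul, pow_zero, pow_one]
      exact (map_X _ _).symm
  exact DFunLike.congr_fun h z

theorem map_addSubst (φ : A →ₐ[ZMod p] A') (B : ℕ) (r : ℕ → A) (z : P p n) :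
    map (φ : A →+* A') (addSubst p n B r z) = addSubst p n B (fun s => φ (r s)) z := by
  have h : (mapAlgHom φ).comp (addSubst p n B r) = addSubst p n B fun s => φ (r s) :=
    algHom_ext fun j => by
      simp only [AlgHom.comp_apply, addSubst_X, mapAlgHom_apply, map_sum, map_mul, map_pow]
      exact Finset.sum_congr rfl fun s _ => congrArg₂ (· * ·) (map_C _ _)
        (congrArg (· ^ p ^ s) (map_X _ _))
  exact DFunLike.congr_fun h z

theorem addSubst_const_mul (B : ℕ) (c : A) (r : ℕ → A) {z : P p n} {d : ℕ}
    (hz : z.IsHomogeneous d) :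
    addSubst p n B (fun s => c * r s) z = C c ^ d * addSubst p n B r z := by
  simp only [addSubst, ← aeval_const_mul_of_isHomogeneous hz, Finset.mul_sum, ← mul_assoc, map_mul]

/-- Composing an additive substitution with the total power, evaluated at `T`, composes the additive
polynomial with `y ↦ y + T y ^ p`. -/
theorem eval₂_addSubst_totalPower [Fact p.Prime] {B : ℕ} {T : A} {r r' : ℕ → A} (h0 : r' 0 = r 0)
    (hsucc : ∀ s, r' (s + 1) = r (s + 1) + T * r s ^ p) (hB : r (B + 1) = 0) (z : P p n) :
    Polynomial.eval₂ (addSubst p n B r : P p n →+* MvPolynomial (Fin n) A) (C T)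
      (totalPower p n z) = addSubst p n (B + 1) r' z := by
  nontriviality A
  have : CharP A p := charP_of_injective_algebraMap (algebraMap (ZMod p) A).injective p
  let evalT : Polynomial (P p n) →+* MvPolynomial (Fin n) A :=
    Polynomial.eval₂RingHom (addSubst p n B r) (C T)
  suffices h : evalT.comp (totalPower p n : P p n →+* Polynomial (P p n)) =
      (addSubst p n (B + 1) r' : P p n →+* MvPolynomial (Fin n) A) from RingHom.congr_fun h z
  refine ringHom_ext' (RingHom.ext_zmod _ _) fun j => ?_
  have hpow : addSubst p n B r (X j) ^ p * C T =
      ∑ s ∈ Finset.range (B + 1), C (T * r s ^ p) * X j ^ p ^ (s + 1) := by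
    rw [addSubst_X, sum_pow_char, Finset.sum_mul]
    refine Finset.sum_congr rfl fun s _ => ?_
    rw [mul_pow, ← pow_mul, ← pow_succ, map_mul, map_pow]
    ring
  calc evalT (totalPower p n (X j))
      = addSubst p n B r (X j) + addSubst p n B r (X j) ^ p * C T := by
        simp [evalT, totalPower, Polynomial.eval₂_pow]
    _ = ∑ s ∈ Finset.range (B + 2), C (r s) * X j ^ p ^ s +
          ∑ s ∈ Finset.range (B + 1), C (T * r s ^ p) * X j ^ p ^ (s + 1) := by
        rw [hpow, Finset.sum_range_succ _ (B + 1), hB, map_zero, zero_mul, add_zero, addSubst_X]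
    _ = addSubst p n (B + 1) r' (X j) := by
        rw [addSubst_X, Finset.sum_range_succ', Finset.sum_range_succ' _ (B + 1), add_right_comm,
          ← Finset.sum_add_distrib, h0]
        simp only [hsucc, map_add, add_mul]

end AddSubst

section Vanishing

variable {K : Type*} [Field K] [IsAlgClosed K]

/-- An additive polynomial of `p`-degree `B + 1` is a composition of one of `p`-degree `B` with
`y ↦ y + T y ^ p`: its coefficients determine those of the other factor recursively, as polynomials
in `T`, and the condition that the factor ends at `B` is a polynomial equation for `T`. -/
theorem exists_additive_factor (p B : ℕ) (r : ℕ → K) :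
    ∃ (T : K) (r' : ℕ → K), r' 0 = 1 ∧ (∀ s, r (s + 1) = r' (s + 1) + T * r' s ^ p) ∧
      r' (B + 1) = 0 := by
  let q : ℕ → Polynomial K := fun s =>
    Nat.rec 1 (fun s q => Polynomial.C (r (s + 1)) - Polynomial.X * q ^ p) s
  have hq (s : ℕ) : q (s + 1) = Polynomial.C (r (s + 1)) - Polynomial.X * q s ^ p := rfl
  have hdeg (s : ℕ) (hs : q s ≠ 0) : 0 < (q (s + 1)).natDegree := by
    rw [hq, Polynomial.natDegree_sub, Polynomial.natDegree_sub_C,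
      Polynomial.natDegree_X_mul (pow_ne_zero _ hs)]
    exact Nat.succ_pos _
  have hne (s : ℕ) : q s ≠ 0 := by
    induction s with
    | zero => exact one_ne_zero
    | succ s ih => exact Polynomial.ne_zero_of_natDegree_gt (hdeg s ih)
  obtain ⟨T, hT⟩ := IsAlgClosed.exists_root (q (B + 1))
    (Polynomial.degree_ne_of_natDegree_ne (hdeg B (hne B)).ne')
  refine ⟨T, fun s => (q s).eval T, Polynomial.eval_one, fun s => ?_, hT⟩
  simp only [hq, Polynomial.eval_sub, Polynomial.eval_C, Polynomial.eval_mul, Polynomial.eval_X,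
    Polynomial.eval_pow, sub_add_cancel]

variable [Fact p.Prime] [Algebra (ZMod p) K] {ℓ : P p n →ₗ[ZMod p] ZMod p}
  {N : Submodule (ZMod p) (P p n)}

theorem extFunctional_addSubst_eq_zero_of_eq_one (hN : ∀ k, ∀ z ∈ N, polyPower p n k z ∈ N)
    (hℓ : ∀ z ∈ N, ℓ z = 0) (B : ℕ) {r : ℕ → K} (hr : r 0 = 1) {z : P p n} (hz : z ∈ N) :
    extFunctional ℓ K (addSubst p n B r z) = 0 := by
  induction B generalizing r z with
  | zero => rw [addSubst_zero hr, extFunctional_map_algebraMap, hℓ z hz, map_zero]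
  | succ B ih =>
    obtain ⟨T, r', hr', hsucc, hB⟩ := exists_additive_factor p B r
    rw [← eval₂_addSubst_totalPower (hr.trans hr'.symm) hsucc hB, Polynomial.eval₂_eq_sum_range,
      map_sum]
    refine Finset.sum_eq_zero fun k _ => ?_
    rw [← map_pow, mul_comm, ← smul_eq_C_mul, map_smul, ← polyPower_apply]
    exact smul_eq_zero_of_right _ (ih hr' (hN k z hz))

theorem extFunctional_addSubst_eq_zero (hN : ∀ k, ∀ z ∈ N, polyPower p n k z ∈ N)
    (hℓ : ∀ z ∈ N, ℓ z = 0) (B : ℕ) {r : ℕ → K} (hr : r 0 ≠ 0) {z : P p n} (hz : z ∈ N) {d : ℕ}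
    (hd : z.IsHomogeneous d) : extFunctional ℓ K (addSubst p n B r z) = 0 := by
  have hr' : r = fun s => r 0 * ((r 0)⁻¹ * r s) := funext fun s => (mul_inv_cancel_left₀ hr _).symm
  rw [hr', addSubst_const_mul _ _ _ hd, ← map_pow, ← smul_eq_C_mul, map_smul,
    extFunctional_addSubst_eq_zero_of_eq_one hN hℓ B (inv_mul_cancel₀ hr) hz, smul_zero]

theorem extFunctional_addSubst_linear_eq_zero (hN : ∀ k, ∀ z ∈ N, polyPower p n k z ∈ N)
    (hℓ : ∀ z ∈ N, ℓ z = 0) (B : ℕ) {σ : Type*} [Fintype σ] (α : σ → K) {z : P p n} (hz : z ∈ N)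
    {d : ℕ} (hd : z.IsHomogeneous d) (hd0 : 0 < d) :
    extFunctional ℓ (MvPolynomial σ K)
      (addSubst p n B (fun s => ∑ j, C (α j) * X j ^ p ^ s) z) = 0 := by
  classical
  set r : ℕ → MvPolynomial σ K := fun s => ∑ j, C (α j) * X j ^ p ^ s with hr
  by_cases hr0 : r 0 = 0
  · have hα (j : σ) : α j = 0 := by
      have h := congrArg (coeff (Finsupp.single j 1)) hr0
      simpa [hr, coeff_sum, coeff_C_mul, coeff_X, Finsupp.single_left_inj] using h
    have hsubst : addSubst p n B r = aeval 0 := congrArg aeval <| funext fun j => by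
      simp [hr, hα]
    rw [hsubst, aeval_zero_of_isHomogeneous hd hd0, map_zero]
  · refine (mul_eq_zero.1 (MvPolynomial.funext fun t => ?_)).resolve_right hr0
    rw [map_mul, map_zero, mul_eq_zero, or_iff_not_imp_right]
    intro ht
    let evalt : MvPolynomial σ K →ₐ[ZMod p] K := (aeval t).restrictScalars (ZMod p)
    have h := extFunctional_map ℓ evalt (addSubst p n B r z)
    rw [map_addSubst, extFunctional_addSubst_eq_zero hN hℓ B ht hz hd] at h
    exact h.symm

end Vanishing

/-! ### The indicator function of the surjective linear maps -/

section LinearAlgebra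

variable {F V X Y : Type*} [Field F] [AddCommGroup V] [Module F V] [AddCommGroup X] [Module F X]
  [AddCommGroup Y] [Module F Y]

theorem exists_equiv_prod_ker {u : V →ₗ[F] X} (hu : Function.Surjective u) :
    ∃ e : V ≃ₗ[F] X × LinearMap.ker u, ∀ x, (e x).1 = u x := by
  obtain ⟨C, hC⟩ := Submodule.exists_isCompl (LinearMap.ker u)
  exact ⟨LinearMap.equivProdOfSurjectiveOfIsCompl u ((LinearMap.ker u).projectionOnto C hC)
    (LinearMap.range_eq_top.2 hu) (by simp) (by simpa using hC), fun _ => rfl⟩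

theorem exists_equiv_comp_eq [FiniteDimensional F V] {u w : V →ₗ[F] X}
    (hu : Function.Surjective u) (hw : Function.Surjective w) :
    ∃ g : V ≃ₗ[F] V, w = u ∘ₗ g.toLinearMap := by
  obtain ⟨eu, heu⟩ := exists_equiv_prod_ker hu
  obtain ⟨ew, hew⟩ := exists_equiv_prod_ker hw
  have hker : Module.finrank F (LinearMap.ker w) = Module.finrank F (LinearMap.ker u) := by
    have hu' := LinearMap.finrank_range_add_finrank_ker u
    have hw' := LinearMap.finrank_range_add_finrank_ker w
    rw [LinearMap.range_eq_top.2 hu] at hu'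
    rw [LinearMap.range_eq_top.2 hw] at hw'
    omega
  let κ : LinearMap.ker w ≃ₗ[F] LinearMap.ker u := LinearEquiv.ofFinrankEq _ _ hker
  refine ⟨(ew.trans ((LinearEquiv.refl F X).prodCongr κ)).trans eu.symm, LinearMap.ext fun x => ?_⟩
  rw [LinearMap.comp_apply, ← heu]
  simp [hew]

theorem surjective_comp_iff_of_surjective {w : V →ₗ[F] Y} {π : Y →ₗ[F] X}
    (hπ : Function.Surjective π) :
    Function.Surjective (π ∘ₗ w) ↔ LinearMap.range w ⊔ LinearMap.ker π = ⊤ := by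
  rw [← LinearMap.range_eq_top, LinearMap.range_comp,
    LinearMap.map_eq_top_iff (LinearMap.range_eq_top.2 hπ)]

theorem setOf_sup_span_singleton_eq_top {U : Submodule F Y} (hU : U ≠ ⊤) {v₀ : Y}
    (h : U ⊔ Submodule.span F {v₀} = ⊤) :
    {v : Y | U ⊔ Submodule.span F {v} = ⊤} = (U : Set Y)ᶜ := by
  have notMem {v : Y} (hv : U ⊔ Submodule.span F {v} = ⊤) : v ∉ U := fun hvU => hU <| by
    rwa [sup_eq_left.2 ((Submodule.span_singleton_le_iff_mem _ _).2 hvU)] at hv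
  have hcoatom : IsCoatom U := by
    rw [← covBy_top_iff, ← h, sup_comm]
    exact Submodule.covBy_span_singleton_sup (notMem h)
  refine Set.ext fun v => ⟨notMem, fun hv => hcoatom.2 _ (left_lt_sup.2 ?_)⟩
  rwa [Submodule.span_singleton_le_iff_mem]

theorem card_dvd_ncard_sup_span_singleton_eq_top [Finite F] [Finite Y] (U : Submodule F Y)
    (hY : 1 < Module.finrank F Y) :
    Nat.card F ∣ {v : Y | U ⊔ Submodule.span F {v} = ⊤}.ncard := by
  have dvd_card {M : Type _} [AddCommGroup M] [Module F M] [Finite M]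
      (hM : 0 < Module.finrank F M) : Nat.card F ∣ Nat.card M := by
    rw [Module.natCard_eq_pow_finrank (K := F) (V := M)]
    exact dvd_pow_self _ hM.ne'
  obtain hempty | ⟨v₀, h⟩ := {v : Y | U ⊔ Submodule.span F {v} = ⊤}.eq_empty_or_nonempty
  · rw [hempty, Set.ncard_empty]
    exact dvd_zero _
  · have hU0 : 0 < Module.finrank F U := by
      have hle := Submodule.finrank_add_le_finrank_add_finrank U (Submodule.span F {v₀})
      have hv₀ := finrank_span_le_card (R := F) ({v₀} : Set Y)
      rw [show U ⊔ Submodule.span F {v₀} = ⊤ from h, finrank_top] at hle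
      rw [Set.toFinset_singleton, Finset.card_singleton] at hv₀
      omega
    by_cases hU : U = ⊤
    · simp only [hU, top_sup_eq, Set.ofPred_true, Set.ncard_univ]
      exact dvd_card (hY.trans' one_pos)
    · rw [setOf_sup_span_singleton_eq_top hU h, ← Nat.dvd_add_right (dvd_card hU0)]
      exact (dvd_card (hY.trans' one_pos)).trans (Set.ncard_add_ncard_compl (U : Set Y)).symm.dvd

end LinearAlgebra

section Indicator

variable {K : Type*} [Field K] {Y Z : Type} [AddCommGroup Y] [Module (ZMod p) Y] [AddCommGroup Z]
  [Module (ZMod p) Z]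

/-- The indicator function of the surjective linear maps from `𝔽_p ^ n` to `Y`. -/
def surjIndicator (K : Type*) [Field K] (n : ℕ) (Y : Type) [AddCommGroup Y] [Module (ZMod p) Y] :
    ((Fin n → ZMod p) →ₗ[ZMod p] Y) → K :=
  Set.indicator {w | Function.Surjective w} 1

open Classical in
theorem surjIndicator_mkQ_comp [Fact p.Prime] (U : Submodule (ZMod p) Y)
    (w : (Fin n → ZMod p) →ₗ[ZMod p] Y) :
    surjIndicator K n (Y ⧸ U) (U.mkQ ∘ₗ w) = if LinearMap.range w ⊔ U = ⊤ then 1 else 0 := by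
  simp only [surjIndicator, Set.indicator_apply, Set.mem_ofPred_eq,
    surjective_comp_iff_of_surjective U.mkQ_surjective, Submodule.ker_mkQ, Pi.one_apply]

variable [Algebra (ZMod p) K]

/-- The value of a polynomial at the images of the standard basis vectors. -/
def evalLin (h : P p n) (φ : (Fin n → ZMod p) →ₗ[ZMod p] K) : K :=
  aeval (fun a => φ (Pi.single a 1)) h

theorem mulVecLin_single (W : Matrix (Fin n) (Fin n) (ZMod p)) (a : Fin n) :
    W.mulVecLin (Pi.single a 1) = ∑ j, W j a • Pi.single j 1 := by
  rw [Matrix.mulVecLin_apply, Matrix.mulVec_single_one]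
  exact pi_eq_sum_univ' _

theorem evalLin_polyAct (g : Matrix (Fin n) (Fin n) (ZMod p)) (h : P p n)
    (φ : (Fin n → ZMod p) →ₗ[ZMod p] K) :
    evalLin (polyAct g h) φ = evalLin h (φ ∘ₗ g.mulVecLin) := by
  rw [evalLin, evalLin, polyAct, ← AlgHom.comp_apply, comp_aeval]
  refine congrArg (fun v => aeval v h) (funext fun j => ?_)
  simp only [LinearMap.comp_apply, mulVecLin_single, map_sum, map_smul, aeval_X]

theorem evalLin_comp_equiv {h : P p n}
    (hinv : ∀ g : GL (Fin n) (ZMod p), polyAct (g : Matrix (Fin n) (Fin n) (ZMod p)) h = h)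
    (φ : (Fin n → ZMod p) →ₗ[ZMod p] K) (e : (Fin n → ZMod p) ≃ₗ[ZMod p] (Fin n → ZMod p)) :
    evalLin h (φ ∘ₗ e.toLinearMap) = evalLin h φ := by
  let g : GL (Fin n) (ZMod p) := Matrix.GeneralLinearGroup.toLin.symm
    ((LinearMap.GeneralLinearGroup.generalLinearEquiv (ZMod p) _).symm e)
  have hg : (g : Matrix (Fin n) (Fin n) (ZMod p)).mulVecLin = e.toLinearMap :=
    Matrix.toLin'_toMatrix' e.toLinearMap
  rw [← hg, ← evalLin_polyAct, hinv]

theorem exists_evalLin_ne_zero [Fact p.Prime] [Infinite K] {h : P p n} (h0 : h ≠ 0) :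
    ∃ φ : (Fin n → ZMod p) →ₗ[ZMod p] K, evalLin h φ ≠ 0 := by
  by_contra! hzero
  refine h0 (map_injective _ (algebraMap (ZMod p) K).injective ?_)
  rw [map_zero]
  refine MvPolynomial.funext fun a => ?_
  have ha := hzero ((Pi.basisFun (ZMod p) (Fin n)).constr (ZMod p) a)
  simp only [evalLin, ← Pi.basisFun_apply, Module.Basis.constr_basis] at ha
  rw [eval_map, ← aeval_def, ha, map_zero]

/-- The span of the functions `w ↦ h (α ∘ w)` of a linear map `w` from `𝔽_p ^ n` to `Y`. -/
def pullbackSpan (K : Type*) [Field K] [Algebra (ZMod p) K] (h : P p n) (Y : Type)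
    [AddCommGroup Y] [Module (ZMod p) Y] :
    Submodule K (((Fin n → ZMod p) →ₗ[ZMod p] Y) → K) :=
  Submodule.span K (Set.range fun (α : Y →ₗ[ZMod p] K) w => evalLin h (α ∘ₗ w))

theorem comp_mem_pullbackSpan {h : P p n} (π : Y →ₗ[ZMod p] Z)
    {f : ((Fin n → ZMod p) →ₗ[ZMod p] Z) → K} (hf : f ∈ pullbackSpan K h Z) :
    (fun w => f (π ∘ₗ w)) ∈ pullbackSpan K h Y := by
  suffices h : pullbackSpan K h Z ≤ (pullbackSpan K h Y).comap
    (LinearMap.funLeft K K fun w => π ∘ₗ w) from h hf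
  rw [pullbackSpan, Submodule.span_le]
  rintro _ ⟨α, rfl⟩
  exact Submodule.subset_span ⟨α ∘ₗ π, rfl⟩

theorem surjIndicator_mem_pullbackSpan_of_minimal [Fact p.Prime] {h : P p n}
    (hinv : ∀ g : GL (Fin n) (ZMod p), polyAct (g : Matrix (Fin n) (Fin n) (ZMod p)) h = h)
    {φ : (Fin n → ZMod p) →ₗ[ZMod p] K} (hφ : evalLin h φ ≠ 0)
    (hmin : ∀ ψ : (Fin n → ZMod p) →ₗ[ZMod p] K, Module.finrank (ZMod p) (LinearMap.range ψ) <
      Module.finrank (ZMod p) (LinearMap.range φ) → evalLin h ψ = 0) [FiniteDimensional (ZMod p) Y]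
    (hY : Module.finrank (ZMod p) Y = Module.finrank (ZMod p) (LinearMap.range φ)) :
    surjIndicator K n Y ∈ pullbackSpan K h Y := by
  let e : Y ≃ₗ[ZMod p] LinearMap.range φ := LinearEquiv.ofFinrankEq _ _ hY
  let α : Y →ₗ[ZMod p] K := (LinearMap.range φ).subtype ∘ₗ e.toLinearMap
  suffices hα : surjIndicator K n Y = (evalLin h φ)⁻¹ • fun w => evalLin h (α ∘ₗ w) by
    rw [hα]
    exact Submodule.smul_mem _ _ (Submodule.subset_span ⟨α, rfl⟩)
  funext w
  rw [Pi.smul_apply, smul_eq_mul]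
  by_cases hw : Function.Surjective w
  · obtain ⟨g, hg⟩ := exists_equiv_comp_eq (w := e.toLinearMap ∘ₗ w) φ.surjective_rangeRestrict
      (e.surjective.comp hw)
    have hαw : α ∘ₗ w = φ ∘ₗ g.toLinearMap := by
      rw [LinearMap.comp_assoc, hg, ← LinearMap.comp_assoc]
      rfl
    rw [surjIndicator, Set.indicator_of_mem hw, hαw, evalLin_comp_equiv hinv, inv_mul_cancel₀ hφ,
      Pi.one_apply]
  · rw [surjIndicator, Set.indicator_of_notMem hw, hmin (α ∘ₗ w), mul_zero]
    calc Module.finrank (ZMod p) (LinearMap.range (α ∘ₗ w))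
        ≤ Module.finrank (ZMod p) (LinearMap.range w) := by
          rw [LinearMap.range_comp]
          exact Submodule.finrank_map_le _ _
      _ < _ := hY ▸ Submodule.finrank_lt (mt LinearMap.range_eq_top.1 hw)

theorem sum_surjIndicator_mkQ_comp [Fact p.Prime] [Fintype Y] (hY : 1 < Module.finrank (ZMod p) Y)
    (w : (Fin n → ZMod p) →ₗ[ZMod p] Y) :
    ∑ v : Y, surjIndicator K n (Y ⧸ Submodule.span (ZMod p) {v})
      ((Submodule.span (ZMod p) {v}).mkQ ∘ₗ w) = 0 := by
  classical
  have : CharP K p := charP_of_injective_algebraMap (algebraMap (ZMod p) K).injective p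
  have hdvd := card_dvd_ncard_sup_span_singleton_eq_top (LinearMap.range w) hY
  rw [Nat.card_zmod, ← CharP.cast_eq_zero_iff K p, Set.ncard_eq_toFinset_card'] at hdvd
  simp only [surjIndicator_mkQ_comp]
  rw [Finset.sum_boole, ← hdvd, Set.toFinset_ofPred]

theorem surjIndicator_mem_pullbackSpan_of_quotient [Fact p.Prime] [Finite Y] {h : P p n}
    (hY : 1 < Module.finrank (ZMod p) Y)
    (hquot : ∀ v : Y, v ≠ 0 → surjIndicator K n (Y ⧸ Submodule.span (ZMod p) {v}) ∈
      pullbackSpan K h (Y ⧸ Submodule.span (ZMod p) {v})) :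
    surjIndicator K n Y ∈ pullbackSpan K h Y := by
  classical
  have := Fintype.ofFinite Y
  have hsum : surjIndicator K n Y = -∑ v ∈ Finset.univ.erase (0 : Y), fun w =>
      surjIndicator K n (Y ⧸ Submodule.span (ZMod p) {v})
        ((Submodule.span (ZMod p) {v}).mkQ ∘ₗ w) := by
    funext w
    have hzero : surjIndicator K n Y w = surjIndicator K n (Y ⧸ Submodule.span (ZMod p) {(0 : Y)})
        ((Submodule.span (ZMod p) {(0 : Y)}).mkQ ∘ₗ w) := by
      rw [surjIndicator_mkQ_comp]
      simp only [surjIndicator, Set.indicator_apply, Set.mem_ofPred_eq,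
        Submodule.span_zero_singleton, sup_bot_eq, LinearMap.range_eq_top, Pi.one_apply]
    rw [Pi.neg_apply, eq_neg_iff_add_eq_zero, Finset.sum_apply, hzero,
      ← sum_surjIndicator_mkQ_comp hY w]
    exact Finset.add_sum_erase _ (fun v => surjIndicator K n (Y ⧸ Submodule.span (ZMod p) {v})
      ((Submodule.span (ZMod p) {v}).mkQ ∘ₗ w)) (Finset.mem_univ 0)
  rw [hsum]
  exact neg_mem <| sum_mem fun v hv =>
    comp_mem_pullbackSpan _ (hquot v (Finset.ne_of_mem_erase hv))

theorem surjIndicator_mem_pullbackSpan [Fact p.Prime] [Infinite K] {h : P p n} {d : ℕ}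
    (hd : h.IsHomogeneous d) (hd0 : 0 < d) (h0 : h ≠ 0)
    (hinv : ∀ g : GL (Fin n) (ZMod p), polyAct (g : Matrix (Fin n) (Fin n) (ZMod p)) h = h)
    [Finite Y] (hY : n ≤ Module.finrank (ZMod p) Y) :
    surjIndicator K n Y ∈ pullbackSpan K h Y := by
  obtain ⟨φ, hφ, hmin⟩ := exists_minimalFor_of_wellFoundedLT _
    (fun φ : (Fin n → ZMod p) →ₗ[ZMod p] K => Module.finrank (ZMod p) (LinearMap.range φ))
    (exists_evalLin_ne_zero h0)
  have hφpos : 0 < Module.finrank (ZMod p) (LinearMap.range φ) := by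
    refine Nat.pos_of_ne_zero fun hrank => hφ ?_
    rw [Submodule.finrank_eq_zero, LinearMap.range_eq_bot] at hrank
    rw [hrank]
    exact aeval_zero_of_isHomogeneous hd hd0
  have hφle : Module.finrank (ZMod p) (LinearMap.range φ) ≤ Module.finrank (ZMod p) Y :=
    (LinearMap.finrank_range_le φ).trans (by rwa [Module.finrank_fin_fun])
  clear hY
  induction hr : Module.finrank (ZMod p) Y using Nat.strong_induction_on generalizing Y with
  | _ r ih =>
    obtain hlt | heq := hφle.lt_or_eq
    · refine surjIndicator_mem_pullbackSpan_of_quotient (by omega) fun v hv => ?_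
      have hquot := Submodule.finrank_quotient_add_finrank (Submodule.span (ZMod p) {v})
      rw [finrank_span_singleton hv] at hquot
      have : Finite (Y ⧸ Submodule.span (ZMod p) {v}) := Quotient.finite _
      exact ih _ (by omega) (by omega) rfl
    · exact surjIndicator_mem_pullbackSpan_of_minimal hinv hφ
        (fun ψ hψ => not_not.1 fun hψ0 => hψ.not_ge (hmin hψ0 hψ.le)) heq.symm

/-- The value of `h` at the product of the row vector `(α e₁, …, α eₙ)` and the generic matrix
`(X (j, a))`. -/
def genericEval (h : P p n) (α : (Fin n → ZMod p) →ₗ[ZMod p] K) : MvPolynomial (Fin n × Fin n) K :=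
  aeval (fun a => ∑ j, C (α (Pi.single j 1)) * X (j, a)) h

theorem aeval_genericEval (h : P p n) (α : (Fin n → ZMod p) →ₗ[ZMod p] K)
    (W : Matrix (Fin n) (Fin n) (ZMod p)) :
    aeval (fun x => algebraMap (ZMod p) K (W x.1 x.2)) (genericEval h α) =
      evalLin h (α ∘ₗ W.mulVecLin) := by
  let evalW := (aeval (R := K) fun x : Fin n × Fin n => algebraMap (ZMod p) K (W x.1 x.2))
  suffices hW : (evalW.restrictScalars (ZMod p)).comp
      (aeval fun a => ∑ j, C (α (Pi.single j 1)) * X (j, a)) =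
      aeval (fun a => α (W.mulVecLin (Pi.single a 1))) from DFunLike.congr_fun hW h
  refine algHom_ext fun a => ?_
  rw [aeval_X, mulVecLin_single, map_sum]
  simp only [map_smul]
  simp [evalW, Algebra.smul_def, mul_comm]

theorem surjIndicator_mulVecLin [Fact p.Prime] (W : Matrix (Fin n) (Fin n) (ZMod p)) :
    surjIndicator K n (Fin n → ZMod p) W.mulVecLin = algebraMap (ZMod p) K (W.det ^ (p - 1)) := by
  classical
  have hsurj : Function.Surjective W.mulVecLin ↔ W.det ≠ 0 := by
    rw [Matrix.coe_mulVecLin, Matrix.mulVec_surjective_iff_isUnit, Matrix.isUnit_iff_isUnit_det,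
      isUnit_iff_ne_zero]
  rw [ZMod.pow_card_sub_one, apply_ite (algebraMap (ZMod p) K), map_one, map_zero]
  simp only [surjIndicator, Set.indicator_apply, Set.mem_ofPred_eq, hsurj, Pi.one_apply]

theorem exists_mem_span_genericEval [Fact p.Prime] [Infinite K] {h : P p n} {d : ℕ}
    (hd : h.IsHomogeneous d) (hd0 : 0 < d) (h0 : h ≠ 0)
    (hinv : ∀ g : GL (Fin n) (ZMod p), polyAct (g : Matrix (Fin n) (Fin n) (ZMod p)) h = h) :
    ∃ Q ∈ Submodule.span K (Set.range (genericEval (K := K) h)),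
      ∀ W : Matrix (Fin n) (Fin n) (ZMod p),
        aeval (fun x => algebraMap (ZMod p) K (W x.1 x.2)) Q =
          algebraMap (ZMod p) K (W.det ^ (p - 1)) := by
  let evalMatrix : MvPolynomial (Fin n × Fin n) K →ₗ[K]
      ((Fin n → ZMod p) →ₗ[ZMod p] (Fin n → ZMod p)) → K := LinearMap.pi fun w =>
    (aeval fun x => algebraMap (ZMod p) K (LinearMap.toMatrix' w x.1 x.2)).toLinearMap
  have hspan : (Submodule.span K (Set.range (genericEval (K := K) h))).map evalMatrix =
      pullbackSpan K h (Fin n → ZMod p) := by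
    rw [Submodule.map_span, ← Set.range_comp, pullbackSpan]
    refine congrArg (fun f => Submodule.span K (Set.range f)) (funext fun α => funext fun w => ?_)
    refine (aeval_genericEval h α (LinearMap.toMatrix' w)).trans ?_
    rw [← Matrix.toLin'_apply', Matrix.toLin'_toMatrix']
  have hmem := surjIndicator_mem_pullbackSpan (K := K) (Y := Fin n → ZMod p) hd hd0 h0 hinv
    (Module.finrank_fin_fun (ZMod p)).ge
  rw [← hspan] at hmem
  obtain ⟨Q, hQ, hQW⟩ := hmem
  refine ⟨Q, hQ, fun W => ?_⟩
  rw [← surjIndicator_mulVecLin, ← hQW]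
  simp [evalMatrix, ← Matrix.toLin'_apply']

end Indicator

/-! ### Sums of powers of `p` -/

theorem pow_le_mul_pow_card (hp : 2 ≤ p) {G c : ℕ} (hc : 0 < c) {s : Multiset ℕ}
    (h : p ^ G ∣ c + (s.map (p ^ ·)).sum) : p ^ G ≤ c * p ^ s.card := by
  induction hk : s.card generalizing s c with
  | zero =>
    rw [Multiset.card_eq_zero.1 hk, Multiset.map_zero, Multiset.sum_zero, add_zero] at h
    rw [pow_zero, mul_one]
    exact Nat.le_of_dvd hc h
  | succ k ih =>
    by_cases hx : ∃ x ∈ s, p ^ x ≤ c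
    · obtain ⟨x, hxs, hxc⟩ := hx
      have hsum : c + (s.map (p ^ ·)).sum = c + p ^ x + ((s.erase x).map (p ^ ·)).sum := by
        rw [add_assoc, Multiset.sum_map_erase (f := (p ^ ·)) hxs]
      calc p ^ G ≤ (c + p ^ x) * p ^ k := ih (by omega) (hsum ▸ h)
            (by rw [Multiset.card_erase_of_mem hxs, hk, Nat.pred_succ])
        _ ≤ c * p * p ^ k := Nat.mul_le_mul_right _ (by nlinarith)
        _ = c * p ^ (k + 1) := by rw [pow_succ', mul_assoc]
    · push Not at hx
      refine (Nat.le_of_not_lt fun hG => ?_).trans (Nat.le_mul_of_pos_right c (by positivity))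
      have hdvd {x : ℕ} (hcx : c < p ^ x) : p ^ (Nat.log p c + 1) ∣ p ^ x :=
        pow_dvd_pow p ((Nat.log_lt_iff_lt_pow hp hc.ne').2 hcx)
      have hsum : p ^ (Nat.log p c + 1) ∣ (s.map (p ^ ·)).sum :=
        Multiset.dvd_sum fun y hy => by
          obtain ⟨x, hxs, rfl⟩ := Multiset.mem_map.1 hy
          exact hdvd (hx x hxs)
      have hlog := (Nat.dvd_add_left hsum).1 ((hdvd hG).trans h)
      exact (Nat.lt_pow_succ_log_self hp c).not_ge (Nat.le_of_dvd hc hlog)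

theorem le_of_pow_dvd_sum_pow {ι : Type*} {s : Finset ι} (hs : s.card < p) {x : ι → ℕ} {g : ℕ}
    (h : p ^ g ∣ ∑ k ∈ s, p ^ x k) {k : ι} (hk : k ∈ s) : g ≤ x k := by
  induction g generalizing k with
  | zero => exact Nat.zero_le _
  | succ g ih =>
    have hle (i : ι) (hi : i ∈ s) : g ≤ x i := ih ((pow_dvd_pow p g.le_succ).trans h) hi
    have hsum : ∑ i ∈ s, p ^ x i = p ^ g * ∑ i ∈ s, p ^ (x i - g) := by
      rw [Finset.mul_sum]
      exact Finset.sum_congr rfl fun i hi => by rw [← pow_add, Nat.add_sub_cancel' (hle i hi)]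
    rw [hsum, pow_succ] at h
    have hdvd : p ∣ (s.filter fun i => x i - g = 0).card := by
      have hpos : 0 < p ^ g := Nat.pow_pos (Nat.zero_lt_of_lt hs)
      rw [← CharP.cast_eq_zero_iff (ZMod p), ← Finset.sum_boole]
      have := (CharP.cast_eq_zero_iff (ZMod p) p _).2 (Nat.dvd_of_mul_dvd_mul_left hpos h)
      simpa [zero_pow_eq] using this
    have hempty := Finset.card_eq_zero.1
      (Nat.eq_zero_of_dvd_of_lt hdvd ((Finset.card_filter_le _ _).trans_lt hs))
    have := Finset.filter_eq_empty_iff.1 hempty hk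
    omega

theorem eq_of_sum_pow_eq {ι : Type*} {s : Finset ι} (hs : s.card < p) {x : ι → ℕ} {g : ℕ}
    (h : ∑ k ∈ s, p ^ x k = s.card * p ^ g) {k : ι} (hk : k ∈ s) : x k = g := by
  have hle (i : ι) (hi : i ∈ s) : g ≤ x i := le_of_pow_dvd_sum_pow hs (h ▸ dvd_mul_left _ _) hi
  have hp : 1 < p := (Nat.succ_le_of_lt (Finset.card_pos.2 ⟨k, hk⟩)).trans_lt hs
  rw [← smul_eq_mul, ← Finset.sum_const, eq_comm, Finset.sum_eq_sum_iff_of_le fun i hi =>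
    Nat.pow_le_pow_right hp.le (hle i hi)] at h
  exact (Nat.pow_right_injective hp (h k hk)).symm

theorem prod_sub_algebraMap [Fact p.Prime] {A : Type*} [CommRing A] [Algebra (ZMod p) A] (t : A) :
    ∏ a : ZMod p, (t - algebraMap (ZMod p) A a) = t ^ p - t := by
  have hp := (Fact.out : p.Prime).one_lt
  have hroots := FiniteField.roots_X_pow_card_sub_X (ZMod p)
  rw [ZMod.card] at hroots
  have hprod := Polynomial.prod_multiset_X_sub_C_of_monic_of_roots_card_eq
    (p := (Polynomial.X ^ p - Polynomial.X : Polynomial (ZMod p)))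
    (Polynomial.monic_X_pow_sub (by rw [Polynomial.degree_X]; exact_mod_cast hp))
    (by rw [hroots, FiniteField.X_pow_card_sub_X_natDegree_eq _ hp]; simp)
  rw [hroots] at hprod
  have hprod' : ∏ a : ZMod p, (Polynomial.X - Polynomial.C a) = Polynomial.X ^ p - Polynomial.X :=
    hprod
  simpa only [map_prod, map_sub, Polynomial.aeval_X, Polynomial.aeval_C, map_pow] using
    congrArg (Polynomial.aeval t) hprod'

/-! ### Polynomials in additive polynomials -/

section AddPoly

variable (p n) (K : Type*) [Field K]

/-- The additive polynomial `∑ₛ (tⱼ yₐ) ^ p ^ s`, where `s ≤ B`. The variables `y` are the outer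
ones, so that its coefficients are polynomials in the variables `t`. -/
def addPoly (B : ℕ) (j a : Fin n) : MvPolynomial (Fin n) (MvPolynomial (Fin n) K) :=
  ∑ s ∈ Finset.range (B + 1), C (X j ^ p ^ s) * X a ^ p ^ s

/-- The substitution of the additive polynomials `∑ₛ (tⱼ yₐ) ^ p ^ s` for the entries of the generic
matrix. -/
def addPolySubst (B : ℕ) :
    MvPolynomial (Fin n × Fin n) K →ₐ[K] MvPolynomial (Fin n) (MvPolynomial (Fin n) K) :=
  aeval fun x => addPoly p n K B x.1 x.2

/-- The span of the monomials in which the exponent of each `tⱼ` is a sum of at most `k` powers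
of `p`. -/
def sumPowSpan (k : ℕ) : Submodule K (MvPolynomial (Fin n) (MvPolynomial (Fin n) K)) :=
  Submodule.span K {q | ∃ (b e : Fin n →₀ ℕ), q = monomial b (monomial e 1) ∧
    ∀ j, ∃ s : Multiset ℕ, s.card ≤ k ∧ e j = (s.map (p ^ ·)).sum}

variable {p n K}

theorem sumPowSpan_mono {k k' : ℕ} (h : k ≤ k') : sumPowSpan p n K k ≤ sumPowSpan p n K k' := by
  refine Submodule.span_mono ?_
  rintro q ⟨b, e, rfl, he⟩
  refine ⟨b, e, rfl, fun j => ?_⟩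
  obtain ⟨s, hs, hsum⟩ := he j
  exact ⟨s, hs.trans h, hsum⟩

theorem monomial_mul_C_X_pow_mul_X_pow (b e : Fin n →₀ ℕ) (j a : Fin n) (M N : ℕ) :
    (monomial b (monomial e 1) * (C (X j ^ M) * X a ^ N) :
      MvPolynomial (Fin n) (MvPolynomial (Fin n) K)) =
      monomial (b + Finsupp.single a N) (monomial (e + Finsupp.single j M) 1) := by
  rw [X_pow_eq_monomial, X_pow_eq_monomial, C_mul_monomial, monomial_mul, mul_one, monomial_mul,
    mul_one]

theorem mul_addPoly_mem_sumPowSpan {k : ℕ} {q : MvPolynomial (Fin n) (MvPolynomial (Fin n) K)}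
    (hq : q ∈ sumPowSpan p n K k) (B : ℕ) (j a : Fin n) :
    q * addPoly p n K B j a ∈ sumPowSpan p n K (k + 1) := by
  refine Submodule.span_induction ?_ (by rw [zero_mul]; exact zero_mem _)
    (fun x y _ _ hx hy => by rw [add_mul]; exact add_mem hx hy)
    (fun c x _ hx => by rw [smul_mul_assoc]; exact Submodule.smul_mem _ _ hx) hq
  rintro _ ⟨b, e, rfl, he⟩
  rw [addPoly, Finset.mul_sum]
  refine sum_mem fun s _ => Submodule.subset_span
    ⟨_, _, monomial_mul_C_X_pow_mul_X_pow b e j a (p ^ s) (p ^ s), fun i => ?_⟩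
  obtain ⟨m, hm, hsum⟩ := he i
  obtain rfl | hij := eq_or_ne i j
  · refine ⟨s ::ₘ m, by rw [Multiset.card_cons]; omega, ?_⟩
    rw [Multiset.map_cons, Multiset.sum_cons, Finsupp.add_apply, Finsupp.single_eq_same, hsum,
      add_comm]
  · refine ⟨m, by omega, ?_⟩
    rw [Finsupp.add_apply, Finsupp.single_eq_of_ne hij, add_zero, hsum]

theorem exists_addPolySubst_mem_sumPowSpan (q : MvPolynomial (Fin n × Fin n) K) :
    ∃ k, ∀ B, addPolySubst p n K B q ∈ sumPowSpan p n K k := by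
  induction q using MvPolynomial.induction_on with
  | C c =>
    refine ⟨0, fun B => ?_⟩
    rw [addPolySubst, aeval_C, Algebra.algebraMap_eq_smul_one]
    exact Submodule.smul_mem _ _ (Submodule.subset_span ⟨0, 0, rfl, fun j => ⟨0, le_rfl, rfl⟩⟩)
  | add f g hf hg =>
    obtain ⟨k, hk⟩ := hf
    obtain ⟨k', hk'⟩ := hg
    refine ⟨max k k', fun B => ?_⟩
    rw [map_add]
    exact add_mem (sumPowSpan_mono (le_max_left _ _) (hk B))
      (sumPowSpan_mono (le_max_right _ _) (hk' B))
  | mul_X f x hf =>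
    obtain ⟨k, hk⟩ := hf
    refine ⟨k + 1, fun B => ?_⟩
    rw [map_mul, addPolySubst, aeval_X]
    exact mul_addPoly_mem_sumPowSpan (hk B) B _ _

variable [Algebra (ZMod p) K] (ℓ : P p n →ₗ[ZMod p] ZMod p)

theorem addPoly_pow_sub [Fact p.Prime] (B : ℕ) (j a : Fin n) :
    addPoly p n K B j a ^ p - addPoly p n K B j a =
      C (X j ^ p ^ (B + 1)) * X a ^ p ^ (B + 1) - C (X j ^ 1) * X a ^ 1 := by
  have : CharP K p := charP_of_injective_algebraMap (algebraMap (ZMod p) K).injective p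
  have hpow : addPoly p n K B j a ^ p = ∑ s ∈ Finset.range (B + 1),
      C (X j ^ p ^ (s + 1)) * X a ^ p ^ (s + 1) := by
    rw [addPoly, sum_pow_char]
    refine Finset.sum_congr rfl fun s _ => ?_
    rw [mul_pow, ← map_pow, ← pow_mul, ← pow_mul, ← pow_succ]
  rw [hpow, addPoly, ← Finset.sum_sub_distrib, Finset.sum_range_sub fun s =>
    (C (X j ^ p ^ s) * X a ^ p ^ s : MvPolynomial (Fin n) (MvPolynomial (Fin n) K)), pow_zero]

theorem extFunctional_C_mul_map {A : Type*} [CommRing A] [Algebra (ZMod p) A] (c : A)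
    (q : P p n) :
    extFunctional ℓ A (C c * map (algebraMap (ZMod p) A) q) = c * algebraMap (ZMod p) A (ℓ q) := by
  rw [← smul_eq_C_mul, map_smul, extFunctional_map_algebraMap, smul_eq_mul]

theorem coeff_extFunctional_mul_X [Fact p.Prime] {k G : ℕ} (hG : k < G)
    {q : MvPolynomial (Fin n) (MvPolynomial (Fin n) K)} (hq : q ∈ sumPowSpan p n K k)
    (j a : Fin n) {m : Fin n →₀ ℕ} (hm : p ^ G ∣ m j) :
    coeff m (extFunctional ℓ (MvPolynomial (Fin n) K) (q * (C (X j ^ 1) * X a ^ 1))) = 0 := by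
  refine Submodule.span_induction ?_ (by rw [zero_mul, map_zero, coeff_zero])
    (fun x y _ _ hx hy => by rw [add_mul, map_add, coeff_add, hx, hy, add_zero])
    (fun c x _ hx => by
      rw [smul_mul_assoc, LinearMap.map_smul_of_tower, coeff_smul, hx, smul_zero]) hq
  rintro _ ⟨b, e, rfl, he⟩
  rw [monomial_mul_C_X_pow_mul_X_pow, extFunctional_monomial, mul_comm, ← Algebra.smul_def,
    coeff_smul, coeff_monomial, if_neg, smul_zero]
  rintro rfl
  obtain ⟨s, hs, hsum⟩ := he j
  rw [Finsupp.add_apply, Finsupp.single_eq_same, hsum, add_comm] at hm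
  have hle := pow_le_mul_pow_card (Fact.out : p.Prime).two_le one_pos hm
  rw [one_mul, Nat.pow_le_pow_iff_right (Fact.out : p.Prime).one_lt] at hle
  omega

theorem coeff_extFunctional_mul_X_pow {M : ℕ}
    (q : MvPolynomial (Fin n) (MvPolynomial (Fin n) K)) (j a : Fin n) {m : Fin n →₀ ℕ}
    (hm : m j < M) (N : ℕ) :
    coeff m (extFunctional ℓ (MvPolynomial (Fin n) K) (q * (C (X j ^ M) * X a ^ N))) = 0 := by
  rw [mul_left_comm, ← smul_eq_C_mul, map_smul, smul_eq_mul, X_pow_eq_monomial,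
    coeff_monomial_mul', if_neg]
  intro h
  have := h j
  rw [Finsupp.single_eq_same] at this
  omega

/-- Modulo monomials that do not contribute to the coefficient at `m`, the additive polynomials
satisfy `T ^ p = T`, the equation of the elements of `ZMod p`. -/
theorem exists_coeff_extFunctional_addPolySubst_eq_zero [Fact p.Prime]
    {q : MvPolynomial (Fin n × Fin n) K}
    (hq : ∀ W : Matrix (Fin n) (Fin n) (ZMod p),
      aeval (fun x => algebraMap (ZMod p) K (W x.1 x.2)) q = 0) :
    ∃ G : ℕ, ∀ (B : ℕ) (m : Fin n →₀ ℕ), (∀ j, p ^ G ∣ m j) → (∀ j, m j < p ^ (B + 1)) →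
      ∀ ℓ : P p n →ₗ[ZMod p] ZMod p,
        coeff m (extFunctional ℓ (MvPolynomial (Fin n) K) (addPolySubst p n K B q)) = 0 := by
  classical
  obtain ⟨c, -, hc⟩ := combinatorial_nullstellensatz_exists_linearCombination
    (fun _ : Fin n × Fin n => Finset.univ.image (algebraMap (ZMod p) K))
    (fun _ => ⟨0, Finset.mem_image.2 ⟨0, Finset.mem_univ _, map_zero _⟩⟩) q (by
      intro x hx
      choose W hW using fun i => (Finset.mem_image.1 (hx i))
      have h := hq (Matrix.of fun j a => W (j, a))
      simp only [Matrix.of_apply, Prod.mk.eta, (hW _).2] at h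
      exact h)
  choose k hk using fun x => exists_addPolySubst_mem_sumPowSpan (p := p) (c x)
  refine ⟨(∑ x, k x) + 1, fun B m hdvd hlt ℓ => ?_⟩
  rw [hc, Finsupp.linearCombination_apply, Finsupp.sum, map_sum, map_sum, coeff_sum]
  refine Finset.sum_eq_zero fun x _ => ?_
  have hfactor (a : ZMod p) : addPolySubst p n K B (X x - C (algebraMap (ZMod p) K a)) =
      addPoly p n K B x.1 x.2 - algebraMap (ZMod p) _ a := by
    rw [map_sub, ← algebraMap_eq, AlgHom.commutes, ← IsScalarTower.algebraMap_apply, addPolySubst,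
      aeval_X]
  have hkx : k x < (∑ x, k x) + 1 := Nat.lt_succ_of_le
    (Finset.single_le_sum (fun _ _ => Nat.zero_le _) (Finset.mem_univ x))
  rw [smul_eq_mul, map_mul, Finset.prod_image fun a _ b _ hab =>
    (algebraMap (ZMod p) K).injective hab, map_prod, Finset.prod_congr rfl fun a _ => hfactor a,
    prod_sub_algebraMap, addPoly_pow_sub, mul_sub, map_sub, coeff_sub,
    coeff_extFunctional_mul_X_pow ℓ _ _ _ (hlt x.1),
    coeff_extFunctional_mul_X ℓ hkx (hk x B) _ _ (hdvd x.1), sub_zero]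

theorem det_addPoly (B : ℕ) :
    (Matrix.of fun j a => addPoly p n K B j a).det =
      ∑ s ∈ Fintype.piFinset fun _ : Fin n => Finset.range (B + 1),
        C (monomial (Finsupp.equivFunOnFinite.symm fun j => p ^ s j) 1) *
          map (algebraMap (ZMod p) (MvPolynomial (Fin n) K)) (mooreMatrix p s).det := by
  classical
  have hrows : (Matrix.of fun j a => addPoly p n K B j a) = fun j =>
      ∑ s ∈ Finset.range (B + 1),
        (C (X j ^ p ^ s) : MvPolynomial (Fin n) (MvPolynomial (Fin n) K)) •
          fun a : Fin n => (X a ^ p ^ s : MvPolynomial (Fin n) (MvPolynomial (Fin n) K)) := by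
    funext j a
    simp [addPoly]
  refine (congrArg Matrix.detRowAlternating hrows).trans
    ((Matrix.detRowAlternating.toMultilinearMap.map_sum_finset _ _).trans
      (Finset.sum_congr rfl fun s _ =>
        (Matrix.detRowAlternating.toMultilinearMap.map_smul_univ _ _).trans ?_))
  rw [smul_eq_mul]
  congr 1
  · rw [← map_prod, monomial_eq, Finsupp.prod_fintype _ _ (by simp), map_one, one_mul]
    rfl
  · rw [RingHom.map_det]
    refine congrArg Matrix.det (Matrix.ext fun j a => ?_)
    simp [mooreMatrix]

theorem coeff_extFunctional_det_pow [Fact p.Prime] {B : ℕ} {g : Fin n → ℕ} (hg : ∀ j, g j ≤ B) :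
    coeff (Finsupp.equivFunOnFinite.symm fun j => (p - 1) * p ^ g j)
      (extFunctional ℓ (MvPolynomial (Fin n) K)
        ((Matrix.of fun j a => addPoly p n K B j a).det ^ (p - 1))) =
      algebraMap (ZMod p) K (ℓ ((mooreMatrix p g).det ^ (p - 1))) := by
  classical
  have hcard : (Finset.univ : Finset (Fin (p - 1))).card = p - 1 := by simp
  rw [det_addPoly, Finset.sum_pow', map_sum, coeff_sum, Finset.sum_eq_single fun _ => g]
  · rw [Finset.prod_const, mul_pow, ← C_pow, ← map_pow (map _), extFunctional_C_mul_map, mul_comm,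
      ← Algebra.smul_def, coeff_smul, monomial_pow, one_pow, coeff_monomial, hcard, if_pos,
      Algebra.algebraMap_eq_smul_one]
    ext j
    simp
  · intro x _ hx
    rw [Finset.prod_mul_distrib, ← map_prod, ← map_prod, extFunctional_C_mul_map, mul_comm,
      ← Algebra.smul_def, coeff_smul, ← monomial_sum_one, coeff_monomial, if_neg, smul_zero]
    intro h
    refine hx (funext fun k => funext fun j => eq_of_sum_pow_eq (x := fun k => x k j)
      (hcard.trans_lt (Nat.sub_lt (Fact.out : p.Prime).pos one_pos)) ?_ (Finset.mem_univ k))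
    have := DFunLike.congr_fun h j
    rw [Finsupp.finsetSum_apply] at this
    rw [hcard]
    exact this
  · refine fun h => absurd ?_ h
    simp only [Fintype.mem_piFinset, Finset.mem_range]
    exact fun _ j => Nat.lt_succ_of_le (hg j)

theorem addPolySubst_genericEval (B : ℕ) (h : P p n) (α : (Fin n → ZMod p) →ₗ[ZMod p] K) :
    addPolySubst p n K B (genericEval h α) =
      addSubst p n B (fun s => ∑ j, C (α (Pi.single j 1)) * X j ^ p ^ s) h := by
  suffices hX : ((addPolySubst p n K B).restrictScalars (ZMod p)).comp
      (aeval fun a => ∑ j, C (α (Pi.single j 1)) * X (j, a)) =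
      addSubst p n B fun s => ∑ j, C (α (Pi.single j 1)) * X j ^ p ^ s from
    DFunLike.congr_fun hX h
  refine algHom_ext fun a => ?_
  simp only [AlgHom.comp_apply, AlgHom.restrictScalars_apply, addPolySubst, aeval_X, addSubst_X,
    map_sum, map_mul, addPoly, Finset.mul_sum, Finset.sum_mul]
  rw [Finset.sum_comm]
  refine Finset.sum_congr rfl fun s _ => Finset.sum_congr rfl fun j _ => ?_
  rw [aeval_C, mul_assoc]
  rfl

end AddPoly

theorem extFunctional_addPolySubst_eq_zero [Fact p.Prime] {K : Type*} [Field K] [IsAlgClosed K]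
    [Algebra (ZMod p) K] {N : Submodule (ZMod p) (P p n)} (hN : ∀ k, ∀ z ∈ N, polyPower p n k z ∈ N)
    {ℓ : P p n →ₗ[ZMod p] ZMod p} (hℓ : ∀ z ∈ N, ℓ z = 0) {h : P p n} (hh : h ∈ N) {d : ℕ}
    (hd : h.IsHomogeneous d) (hd0 : 0 < d) (B : ℕ) {Q : MvPolynomial (Fin n × Fin n) K}
    (hQ : Q ∈ Submodule.span K (Set.range (genericEval (K := K) h))) :
    extFunctional ℓ (MvPolynomial (Fin n) K) (addPolySubst p n K B Q) = 0 := by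
  refine Submodule.span_induction ?_ (by rw [map_zero, map_zero])
    (fun x y _ _ hx hy => by rw [map_add, map_add, hx, hy, add_zero])
    (fun c x _ hx => by rw [map_smul, LinearMap.map_smul_of_tower, hx, smul_zero]) hQ
  rintro _ ⟨α, rfl⟩
  rw [addPolySubst_genericEval]
  exact extFunctional_addSubst_linear_eq_zero hN hℓ _ _ hh hd hd0

theorem exists_mooreMatrix_det_pow_mem [Fact p.Prime] {N : Submodule (ZMod p) (P p n)}
    (hN : ∀ k, ∀ z ∈ N, polyPower p n k z ∈ N) {h : P p n} (hh : h ∈ N) {d : ℕ}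
    (hd : h.IsHomogeneous d) (hd0 : 0 < d) (h0 : h ≠ 0)
    (hinv : ∀ g : GL (Fin n) (ZMod p), polyAct (g : Matrix (Fin n) (Fin n) (ZMod p)) h = h) :
    ∃ G : ℕ, ∀ g : Fin n → ℕ, (∀ j, G ≤ g j) → (mooreMatrix p g).det ^ (p - 1) ∈ N := by
  let K := AlgebraicClosure (ZMod p)
  let W : Matrix (Fin n) (Fin n) (MvPolynomial (Fin n × Fin n) K) := Matrix.of fun j a => X (j, a)
  obtain ⟨Q, hQ, hQdet⟩ := exists_mem_span_genericEval (K := K) hd hd0 h0 hinv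
  obtain ⟨G, hG⟩ := exists_coeff_extFunctional_addPolySubst_eq_zero (q := Q - W.det ^ (p - 1))
    fun V => by
      rw [map_sub, hQdet, map_pow, map_pow, RingHom.map_det, AlgHom.map_det, sub_eq_zero]
      refine congrArg (Matrix.det · ^ (p - 1)) (Matrix.ext fun j a => ?_)
      exact Eq.symm <| aeval_X (fun x : Fin n × Fin n => algebraMap (ZMod p) K (V x.1 x.2)) (j, a)
  refine ⟨G, fun g hg => ?_⟩
  by_contra hmem
  obtain ⟨ℓ, hℓ, hker⟩ := Submodule.exists_le_ker_of_notMem hmem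
  have hgB (j : Fin n) : g j ≤ ∑ j, g j :=
    Finset.single_le_sum (fun _ _ => Nat.zero_le _) (Finset.mem_univ j)
  have hW : addPolySubst p n K (∑ j, g j) W.det =
      (Matrix.of fun j a => addPoly p n K (∑ j, g j) j a).det := by
    rw [AlgHom.map_det]
    exact congrArg Matrix.det (Matrix.ext fun j a => aeval_X _ _)
  have hlt (j : Fin n) : (p - 1) * p ^ g j < p ^ ((∑ j, g j) + 1) :=
    calc (p - 1) * p ^ g j < p * p ^ g j := Nat.mul_lt_mul_of_pos_right
          (Nat.sub_lt (Fact.out : p.Prime).pos one_pos) (Nat.pow_pos (Fact.out : p.Prime).pos)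
      _ = p ^ (g j + 1) := (pow_succ' p (g j)).symm
      _ ≤ p ^ ((∑ j, g j) + 1) :=
        Nat.pow_le_pow_right (Fact.out : p.Prime).pos (Nat.succ_le_succ (hgB j))
  have h := hG (∑ j, g j) (Finsupp.equivFunOnFinite.symm fun j => (p - 1) * p ^ g j)
    (fun j => Dvd.dvd.mul_left (pow_dvd_pow p (hg j)) _) hlt ℓ
  rw [map_sub, map_sub, extFunctional_addPolySubst_eq_zero hN (fun z hz => hker hz) hh hd hd0 _ hQ,
    zero_sub, coeff_neg, map_pow, hW, coeff_extFunctional_det_pow ℓ hgB, neg_eq_zero,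
    map_eq_zero] at h
  exact hℓ h

theorem power_algebraMap (k : ℕ) (f : P p n) :
    power p n k (algebraMap (P p n) (H p n) f) =
      algebraMap (P p n) (H p n) (polyPower p n k f) := rfl

theorem polyAct_eq_of_algebraMap_mem_D [Fact p.Prime] {h : P p n}
    (hh : algebraMap (P p n) (H p n) h ∈ D p n) (g : GL (Fin n) (ZMod p)) :
    polyAct (g : Matrix (Fin n) (Fin n) (ZMod p)) h = h := by
  have hg := congrArg polyPart (mem_D.1 hh g)
  rwa [polyPart_act, polyPart_algebraMap] at hg

section SteenrodSubmodule

variable [Fact p.Prime] {N N' : Submodule (SteenrodAlgebra p) (H p n)}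

theorem exists_algebraMap_mooreMatrix_det_pow_mem (hND : N ≤ D p n) {k : ℕ} (hk : 0 < k)
    {z : H p n} (hz : z ∈ degreePart p n k) (hzN : z ∈ N) (h0 : z ≠ 0) :
    ∃ G : ℕ, ∀ g : Fin n → ℕ, (∀ j, G ≤ g j) →
      algebraMap (P p n) (H p n) ((mooreMatrix p g).det ^ (p - 1)) ∈ N := by
  obtain ⟨h, d, hhN, hh0, hd, hd0⟩ := exists_algebraMap_mem hk hz hzN h0
  let polynomials : Submodule (ZMod p) (P p n) := (N.restrictScalars (ZMod p)).comap
    ((Algebra.linearMap (P p n) (H p n)).restrictScalars (ZMod p))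
  refine exists_mooreMatrix_det_pow_mem (N := polynomials) (fun i f hf => ?_) hhN hd hd0 hh0
    (polyAct_eq_of_algebraMap_mem_D (hND hhN))
  change algebraMap (P p n) (H p n) (polyPower p n i f) ∈ N
  rw [← power_algebraMap, ← powerElem_smul]
  exact N.smul_mem _ hf

theorem inf_ne_bot_of_mem_degreePart (hND : N ≤ D p n) (hND' : N' ≤ D p n) {k k' : ℕ} (hk : 0 < k)
    (hk' : 0 < k') {z z' : H p n} (hz : z ∈ degreePart p n k) (hz' : z' ∈ degreePart p n k')
    (hzN : z ∈ N) (hzN' : z' ∈ N') (h0 : z ≠ 0) (h0' : z' ≠ 0) : N ⊓ N' ≠ ⊥ := by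
  obtain ⟨G, hG⟩ := exists_algebraMap_mooreMatrix_det_pow_mem hND hk hz hzN h0
  obtain ⟨G', hG'⟩ := exists_algebraMap_mooreMatrix_det_pow_mem hND' hk' hz' hzN' h0'
  let g (j : Fin n) : ℕ := max G G' + j
  have hdet : (mooreMatrix p g).det ^ (p - 1) ≠ 0 := pow_ne_zero _ <|
    mooreMatrix_det_ne_zero fun i j hij => Fin.ext (Nat.add_left_cancel hij)
  refine (Submodule.ne_bot_iff _).2 ⟨_, ⟨hG g fun j => ?_, hG' g fun j => ?_⟩, fun h => hdet ?_⟩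
  · exact (le_max_left G G').trans (Nat.le_add_right _ _)
  · exact (le_max_right G G').trans (Nat.le_add_right _ _)
  · rw [← polyPart_algebraMap ((mooreMatrix p g).det ^ (p - 1)), h, map_zero]

end SteenrodSubmodule

/-! ### Linear forms -/

section LinForm

/-- The linear form `∑ᵢ vᵢ Xᵢ` with coefficient vector `v`. -/
def linForm {σ R : Type*} [Fintype σ] [CommSemiring R] (v : σ → R) : MvPolynomial σ R :=
  ∑ i, v i • X i

variable {σ : Type*} [Fintype σ]

section CommSemiring

variable {R : Type*} [CommSemiring R]

theorem linForm_isHomogeneous (v : σ → R) : (linForm v).IsHomogeneous 1 :=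
  IsHomogeneous.sum _ _ _ fun i _ => by
    rw [smul_eq_C_mul]
    exact (isHomogeneous_X _ _).C_mul _

theorem linForm_add (v w : σ → R) : linForm (v + w) = linForm v + linForm w := by
  simp only [linForm, Pi.add_apply, add_smul, Finset.sum_add_distrib]

theorem linForm_single [DecidableEq σ] (i : σ) (c : R) : linForm (Pi.single i c) = c • X i := by
  simp [linForm, Pi.single_apply]

theorem coeff_linForm (v : σ → R) (i : σ) : coeff (Finsupp.single i 1) (linForm v) = v i := by
  classical simp [linForm, coeff_sum, coeff_X, Finsupp.single_left_inj]

theorem linForm_ne_zero {v : σ → R} (hv : v ≠ 0) : linForm v ≠ 0 := by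
  obtain ⟨i, hi⟩ := Function.ne_iff.1 hv
  exact fun h => hi (by rw [← coeff_linForm v i, h, coeff_zero, Pi.zero_apply])

theorem prod_linForm_pow_isHomogeneous {ι : Type*} [Fintype ι] (V : ι → σ → R) (e : ι → ℕ) :
    (∏ i, linForm (V i) ^ e i).IsHomogeneous (∑ i, e i) :=
  IsHomogeneous.prod _ _ _ fun i _ => by
    simpa only [one_mul] using (linForm_isHomogeneous (V i)).pow (e i)

end CommSemiring

theorem X_pow_dvd_iff {σ R : Type*} [CommRing R] {f : MvPolynomial σ R} {k : σ} {e : ℕ} :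
    X k ^ e ∣ f ↔ ∀ m ∈ f.support, e ≤ m k := by
  simp only [X_pow_eq_monomial, monomial_one_dvd_iff_modMonomial_eq_zero, ← Finsupp.single_le_iff]
  refine ⟨fun h m hm => ?_, fun h => ext _ _ fun m => ?_⟩
  · by_contra hle
    rw [mem_support_iff, ← coeff_modMonomial_of_not_le _ hle, h, coeff_zero] at hm
    exact hm rfl
  · by_cases hle : Finsupp.single k e ≤ m
    · rw [coeff_modMonomial_of_le _ hle, coeff_zero]
    · rw [coeff_modMonomial_of_not_le _ hle, coeff_zero]
      exact notMem_support_iff.1 fun hm => hle (h m hm)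

section IsDomain

variable {σ R : Type*} [CommRing R] [IsDomain R] {q f : MvPolynomial σ R} {a b : ℕ}

theorem le_of_dvd_of_isHomogeneous (hq : q.IsHomogeneous a) (hf : f.IsHomogeneous b) (hf0 : f ≠ 0)
    (h : q ∣ f) : a ≤ b := by
  rw [← hf.totalDegree hf0, ← hq.totalDegree (ne_zero_of_dvd_ne_zero hf0 h)]
  exact totalDegree_le_of_dvd_of_isDomain h hf0

theorem exists_eq_smul_of_dvd_of_isHomogeneous (hq : q.IsHomogeneous a) (hf : f.IsHomogeneous a)
    (h : q ∣ f) : ∃ c : R, f = c • q := by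
  obtain ⟨u, rfl⟩ := h
  by_cases hf0 : q * u = 0
  · exact ⟨0, by rw [hf0, zero_smul]⟩
  have hq0 := left_ne_zero_of_mul hf0
  have hdeg := totalDegree_mul_of_isDomain hq0 (right_ne_zero_of_mul hf0)
  rw [hf.totalDegree hf0, hq.totalDegree hq0] at hdeg
  have hC := totalDegree_eq_zero_iff_eq_C.1 (show u.totalDegree = 0 by omega)
  exact ⟨coeff 0 u, by rw [smul_eq_C_mul, mul_comm, ← hC]⟩

end IsDomain

section Field

variable {K : Type*} [Field K]

theorem linForm_irreducible {v : σ → K} (hv : v ≠ 0) : Irreducible (linForm v) := by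
  refine irreducible_of_totalDegree_eq_one
    ((linForm_isHomogeneous v).totalDegree (linForm_ne_zero hv)) fun x hx => ?_
  obtain ⟨i, hi⟩ := Function.ne_iff.1 hv
  have hdvd := hx (Finsupp.single i 1)
  rw [coeff_linForm] at hdvd
  rw [isUnit_iff_ne_zero]
  rintro rfl
  exact hi (zero_dvd_iff.1 hdvd)

theorem exists_eq_smul_of_linForm_dvd {v w : σ → K} (h : linForm v ∣ linForm w) :
    ∃ c : K, w = c • v := by
  obtain ⟨c, hc⟩ :=
    exists_eq_smul_of_dvd_of_isHomogeneous (linForm_isHomogeneous v) (linForm_isHomogeneous w) h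
  refine ⟨c, funext fun i => ?_⟩
  rw [← coeff_linForm w i, hc, coeff_smul, coeff_linForm, Pi.smul_apply]

theorem prod_linForm_pow_dvd {ι : Type*} [Fintype ι] {V : ι → σ → K} (hV : ∀ i, V i ≠ 0)
    (hV' : ∀ i j, i ≠ j → ∀ c : K, V j ≠ c • V i) {e : ι → ℕ} {f : MvPolynomial σ K}
    (h : ∀ i, linForm (V i) ^ e i ∣ f) : ∏ i, linForm (V i) ^ e i ∣ f := by
  refine Fintype.prod_dvd_of_isRelPrime (fun i j hij => IsRelPrime.pow ?_) h
  rw [(linForm_irreducible (hV i)).isRelPrime_iff_not_dvd]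
  intro hd
  obtain ⟨c, hc⟩ := exists_eq_smul_of_linForm_dvd hd
  exact hV' i j hij c hc

open scoped LinearAlgebra.Projectivization in
theorem prod_projectivization_linForm_pow_dvd [Fintype (ℙ K (σ → K))] {e : ℙ K (σ → K) → ℕ}
    {f : MvPolynomial σ K} (h : ∀ ℓ : ℙ K (σ → K), linForm ℓ.rep ^ e ℓ ∣ f) :
    ∏ ℓ : ℙ K (σ → K), linForm ℓ.rep ^ e ℓ ∣ f := by
  refine prod_linForm_pow_dvd (fun ℓ => ℓ.rep_nonzero) (fun ℓ ℓ' hne c hc => hne ?_) h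
  rw [← ℓ.mk_rep, ← ℓ'.mk_rep, eq_comm, Projectivization.mk_eq_mk_iff']
  exact ⟨c, hc.symm⟩

end Field

end LinForm

/-! ### Substitutions in one variable -/

/-- The matrix of the substitution of `∑ᵢ vᵢ yᵢ` for `yₖ` that fixes the other variables. -/
def colMatrix (k : Fin n) (v : Fin n → ZMod p) : Matrix (Fin n) (Fin n) (ZMod p) :=
  Matrix.updateCol 1 k v

theorem colMatrix_det (k : Fin n) (v : Fin n → ZMod p) : (colMatrix k v).det = v k := by
  rw [colMatrix, ← Matrix.cramer_apply, Matrix.cramer_one, Module.End.one_apply]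

theorem act_colMatrix [Fact p.Prime] {k : Fin n} {v : Fin n → ZMod p} (hv : v k ≠ 0) {z : H p n}
    (hz : z ∈ D p n) : act (colMatrix k v) z = z :=
  mem_D.1 hz (Matrix.GeneralLinearGroup.mkOfDetNeZero (colMatrix k v) (by rwa [colMatrix_det]))

theorem polyAct_X (g : Matrix (Fin n) (Fin n) (ZMod p)) (j : Fin n) :
    polyAct g (X j) = linForm fun i => g i j := aeval_X _ _

theorem polyAct_colMatrix_X_self (k : Fin n) (v : Fin n → ZMod p) :
    polyAct (colMatrix k v) (X k) = linForm v := by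
  rw [polyAct_X]
  simp only [colMatrix, Matrix.updateCol_self]

theorem polyAct_colMatrix_X_of_ne {j k : Fin n} (h : j ≠ k) (v : Fin n → ZMod p) :
    polyAct (colMatrix k v) (X j) = X j := by
  rw [polyAct_X, ← one_smul (ZMod p) (X j), ← linForm_single]
  refine congrArg linForm (funext fun i => ?_)
  rw [colMatrix, Matrix.updateCol_ne h, Matrix.one_apply, Pi.single_apply]

theorem pderivX_act_colMatrix_self (k : Fin n) (v : Fin n → ZMod p) (z : H p n) :
    pderivX k (act (colMatrix k v) z) = v k • act (colMatrix k v) (pderivX k z) := by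
  rw [pderivX_act, Fintype.sum_eq_single k, colMatrix, Matrix.updateCol_self]
  intro j hj
  rw [colMatrix, Matrix.updateCol_ne hj, Matrix.one_apply_ne hj.symm, zero_smul]

theorem pderivX_act_colMatrix_of_ne {i k : Fin n} (h : i ≠ k) (v : Fin n → ZMod p) (z : H p n) :
    pderivX i (act (colMatrix k v) z) = act (colMatrix k v) (pderivX i z) +
      v i • act (colMatrix k v) (pderivX k z) := by
  rw [pderivX_act, Fintype.sum_eq_add i k h]
  · simp only [colMatrix, Matrix.updateCol_self, Matrix.updateCol_ne h, Matrix.one_apply_eq,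
      one_smul]
  · rintro j ⟨hji, hjk⟩
    rw [colMatrix, Matrix.updateCol_ne hjk, Matrix.one_apply_ne hji.symm, zero_smul]

theorem pderivX_pderivList_act_colMatrix {k : Fin n} {S : List (Fin n)} (hk : k ∉ S)
    (v : Fin n → ZMod p) (z : H p n) :
    pderivX k (pderivList S (act (colMatrix k v) z)) =
      v k • act (colMatrix k v) (pderivX k (pderivList S z)) := by
  induction S with
  | nil => exact pderivX_act_colMatrix_self k v z
  | cons s S ih =>
    rw [List.mem_cons, not_or] at hk
    rw [pderivList_cons, pderivX_comm, ih hk.2, LinearMap.map_smul_of_tower,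
      pderivX_act_colMatrix_of_ne (Ne.symm hk.1), pderivX_pderivX, map_zero, smul_zero, add_zero,
      pderivList_cons, pderivX_comm k s, map_neg, smul_neg]

theorem pderivList_act_colMatrix_of_mem {k : Fin n} {S : List (Fin n)} (hS : S.Nodup) (hk : k ∈ S)
    (v : Fin n → ZMod p) (z : H p n) :
    pderivList S (act (colMatrix k v) z) = v k • act (colMatrix k v) (pderivList S z) := by
  induction S with
  | nil => exact absurd hk List.not_mem_nil
  | cons s S ih =>
    rw [List.nodup_cons] at hS
    by_cases hsk : s = k
    · subst hsk
      exact pderivX_pderivList_act_colMatrix hS.1 v z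
    · have hkS : k ∈ S := (List.mem_cons.1 hk).resolve_left (Ne.symm hsk)
      rw [pderivList_cons, ih hS.2 hkS, LinearMap.map_smul_of_tower,
        pderivX_act_colMatrix_of_ne hsk, pderivX_pderivList_of_mem hkS, map_zero, smul_zero,
        add_zero, pderivList_cons]

theorem pderivList_act_colMatrix_of_notMem {k : Fin n} {S : List (Fin n)} (hk : k ∉ S)
    {v : Fin n → ZMod p} (hv : ∀ s ∈ S, v s = 0) (z : H p n) :
    pderivList S (act (colMatrix k v) z) = act (colMatrix k v) (pderivList S z) := by
  induction S with
  | nil => rfl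
  | cons s S ih =>
    rw [List.mem_cons, not_or] at hk
    rw [pderivList_cons, ih hk.2 fun t ht => hv t (List.mem_cons_of_mem _ ht),
      pderivX_act_colMatrix_of_ne (Ne.symm hk.1), hv s List.mem_cons_self, zero_smul, add_zero,
      pderivList_cons]

theorem polyAct_colMatrix_single_monomial (k : Fin n) (c a : ZMod p) (m : Fin n →₀ ℕ) :
    polyAct (colMatrix k (Pi.single k c)) (monomial m a) = c ^ m k • monomial m a := by
  have hX (j : Fin n) : polyAct (colMatrix k (Pi.single k c)) (X j) =
      C (if j = k then c else 1) * X j := by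
    split_ifs with h
    · rw [h, polyAct_colMatrix_X_self, linForm_single, smul_eq_C_mul]
    · rw [polyAct_colMatrix_X_of_ne h, map_one, one_mul]
  have hc : ∏ j, (if j = k then c else 1) ^ m j = c ^ m k := by
    simp only [ite_pow, one_pow, Finset.prod_ite_eq', Finset.mem_univ, if_true]
  rw [monomial_eq, Finsupp.prod_fintype _ _ fun _ => pow_zero _, map_mul, map_prod, algHom_C]
  simp only [map_pow, hX, mul_pow, Finset.prod_mul_distrib]
  simp only [← map_pow]
  rw [← map_prod, hc, smul_eq_C_mul, algebraMap_eq]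
  ring

theorem coeff_polyAct_colMatrix_single (k : Fin n) (c : ZMod p) (f : P p n) (m : Fin n →₀ ℕ) :
    coeff m (polyAct (colMatrix k (Pi.single k c)) f) = c ^ m k * coeff m f := by
  induction f using MvPolynomial.induction_on' with
  | monomial u a =>
    rw [polyAct_colMatrix_single_monomial, coeff_smul, coeff_monomial, smul_eq_mul]
    split_ifs with h
    · rw [h]
    · rw [mul_zero, mul_zero]
  | add f g hf hg => rw [map_add, coeff_add, hf, hg, coeff_add, mul_add]

theorem X_dvd_polyAct_colMatrix_sub (s b : Fin n) (f : P p n) :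
    X b ∣ polyAct (colMatrix s (Pi.single s 1 + Pi.single b 1)) f - f := by
  rw [← Ideal.Quotient.eq_zero_iff_dvd, map_sub, sub_eq_zero]
  let π := Ideal.Quotient.mkₐ (ZMod p) (Ideal.span {(X b : P p n)})
  suffices h : π.comp (polyAct (colMatrix s (Pi.single s 1 + Pi.single b 1))) = π from
    DFunLike.congr_fun h f
  refine algHom_ext fun j => ?_
  rw [AlgHom.comp_apply]
  by_cases hj : j = s
  · rw [hj, polyAct_colMatrix_X_self, linForm_add, linForm_single, linForm_single, one_smul,
      one_smul, map_add, add_eq_left]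
    exact (Ideal.Quotient.eq_zero_iff_dvd _ _).2 dvd_rfl
  · rw [polyAct_colMatrix_X_of_ne hj]

/-! ### Divisibility of the coefficients of invariants -/

theorem sub_one_dvd_of_forall_pow_mul_eq [Fact p.Prime] {a : ZMod p} (ha : a ≠ 0) {e : ℕ}
    (h : ∀ c : ZMod p, c ≠ 0 → c ^ e * a = a) : p - 1 ∣ e := by
  rw [← ZMod.card p, ← FiniteField.forall_pow_eq_one_iff (ZMod p) e]
  refine fun x => Units.ext ?_
  rw [Units.val_pow_eq_pow_val, Units.val_one]
  exact mul_right_cancel₀ ha (by rw [h x x.ne_zero, one_mul])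

section Invariant

variable [Fact p.Prime] {z : H p n} {S : List (Fin n)} {k : Fin n} {v : Fin n → ZMod p}

theorem coeffX_eq_smul_polyAct_of_mem (hz : z ∈ D p n) (hS : S.Nodup) (hk : k ∈ S)
    (hv : v k ≠ 0) : coeffX S z = v k • polyAct (colMatrix k v) (coeffX S z) := by
  conv_lhs => rw [← act_colMatrix hv hz]
  rw [coeffX_apply, pderivList_act_colMatrix_of_mem hS hk, LinearMap.map_smul_of_tower,
    polyPart_act, coeffX_apply]

theorem coeffX_eq_polyAct_of_notMem (hz : z ∈ D p n) (hk : k ∉ S) (hv : v k ≠ 0)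
    (hvS : ∀ s ∈ S, v s = 0) : coeffX S z = polyAct (colMatrix k v) (coeffX S z) := by
  conv_lhs => rw [← act_colMatrix hv hz]
  rw [coeffX_apply, pderivList_act_colMatrix_of_notMem hk hvS, polyPart_act, coeffX_apply]

theorem sub_one_dvd_add_exponent {f : P p n} {e : ℕ}
    (hf : ∀ c : ZMod p, c ≠ 0 → f = c ^ e • polyAct (colMatrix k (Pi.single k c)) f)
    {m : Fin n →₀ ℕ} (hm : m ∈ f.support) : p - 1 ∣ e + m k :=
  sub_one_dvd_of_forall_pow_mul_eq (mem_support_iff.1 hm) fun c hc => by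
    conv_rhs => rw [hf c hc, coeff_smul, coeff_polyAct_colMatrix_single, smul_eq_mul]
    rw [pow_add, mul_assoc]

theorem sub_one_dvd_one_add_exponent_of_mem (hz : z ∈ D p n) (hS : S.Nodup) (hk : k ∈ S)
    {m : Fin n →₀ ℕ} (hm : m ∈ (coeffX S z).support) : p - 1 ∣ 1 + m k :=
  sub_one_dvd_add_exponent (fun c hc => by
    simpa only [Pi.single_eq_same, pow_one] using coeffX_eq_smul_polyAct_of_mem hz hS hk
      (v := Pi.single k c) (by rwa [Pi.single_eq_same])) hm

theorem sub_one_dvd_exponent_of_notMem (hz : z ∈ D p n) (hk : k ∉ S) {m : Fin n →₀ ℕ}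
    (hm : m ∈ (coeffX S z).support) : p - 1 ∣ m k := by
  rw [← zero_add (m k)]
  refine sub_one_dvd_add_exponent (fun c hc => ?_) hm
  rw [pow_zero, one_smul]
  exact coeffX_eq_polyAct_of_notMem hz hk (by rwa [Pi.single_eq_same])
    fun s hs => Pi.single_eq_of_ne (ne_of_mem_of_not_mem hs hk) _

/-- The substitution `y_s ↦ y_s + y_b`, for an `s` in `S`, adds the coefficient at `S` to the one
at `(S \ {s}) ∪ {b}`, and it is the identity modulo `y_b`. -/
theorem X_dvd_coeffX (hz : z ∈ D p n) (hS : S.Nodup) (hS0 : S ≠ []) {b : Fin n} (hb : b ∉ S) :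
    X b ∣ coeffX S z := by
  obtain ⟨s, T, rfl⟩ := List.exists_cons_of_ne_nil hS0
  obtain ⟨hsT, -⟩ := List.nodup_cons.1 hS
  obtain ⟨hbs, hbT⟩ := not_or.1 (mt List.mem_cons.2 hb)
  let v : Fin n → ZMod p := Pi.single s 1 + Pi.single b 1
  have hvs : v s = 1 := by simp [v, Ne.symm hbs]
  have hvb : v b = 1 := by simp [v, hbs]
  have hvT (t : Fin n) (ht : t ∈ T) : v t = 0 := by
    simp [v, ne_of_mem_of_not_mem ht hsT, ne_of_mem_of_not_mem ht hbT]
  have hcoeff : coeffX (b :: T) z =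
      polyAct (colMatrix s v) (coeffX (b :: T) z + coeffX (s :: T) z) := by
    conv_lhs => rw [← act_colMatrix (k := s) (v := v) (by rw [hvs]; exact one_ne_zero) hz]
    rw [coeffX_apply, pderivList_cons, pderivList_act_colMatrix_of_notMem hsT hvT,
      pderivX_act_colMatrix_of_ne hbs, hvb, one_smul, ← map_add, polyPart_act, map_add,
      coeffX_apply, coeffX_apply, pderivList_cons, pderivList_cons]
  have hmod := dvd_add (X_dvd_polyAct_colMatrix_sub s b (coeffX (b :: T) z))
    (X_dvd_polyAct_colMatrix_sub s b (coeffX (s :: T) z))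
  rw [map_add] at hcoeff
  rw [← dvd_neg]
  convert hmod using 1
  linear_combination hcoeff

theorem X_pow_dvd_coeffX (hz : z ∈ D p n) (hS : S.Nodup) (hS0 : S ≠ []) {b : Fin n}
    (hb : b ∉ S) : X b ^ (p - 1) ∣ coeffX S z := by
  have hpos : ∀ m ∈ (coeffX S z).support, 1 ≤ m b :=
    X_pow_dvd_iff.1 (by rw [pow_one]; exact X_dvd_coeffX hz hS hS0 hb)
  exact X_pow_dvd_iff.2 fun m hm =>
    Nat.le_of_dvd (hpos m hm) (sub_one_dvd_exponent_of_notMem hz hb hm)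

theorem linForm_pow_sub_one_dvd_coeffX (hz : z ∈ D p n) (hS : S.Nodup) (hS0 : S ≠ []) (hv : v ≠ 0)
    (hvS : ∀ s ∈ S, v s = 0) : linForm v ^ (p - 1) ∣ coeffX S z := by
  obtain ⟨k, hk⟩ := Function.ne_iff.1 hv
  have hkS : k ∉ S := fun hkS => hk (hvS k hkS)
  rw [coeffX_eq_polyAct_of_notMem hz hkS hk hvS, ← polyAct_colMatrix_X_self k v, ← map_pow]
  exact map_dvd _ (X_pow_dvd_coeffX hz hS hS0 hkS)

theorem linForm_pow_sub_two_dvd_coeffX (hz : z ∈ D p n) (hS : S.Nodup) (hS0 : S ≠ [])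
    (hv : v ≠ 0) : linForm v ^ (p - 2) ∣ coeffX S z := by
  by_cases hvS : ∀ s ∈ S, v s = 0
  · exact (pow_dvd_pow _ (by omega)).trans (linForm_pow_sub_one_dvd_coeffX hz hS hS0 hv hvS)
  · push Not at hvS
    obtain ⟨s, hs, hvs⟩ := hvS
    have hX : X s ^ (p - 2) ∣ coeffX S z := X_pow_dvd_iff.2 fun m hm => by
      have := Nat.le_of_dvd (by omega) (sub_one_dvd_one_add_exponent_of_mem hz hS hs hm)
      omega
    rw [coeffX_eq_smul_polyAct_of_mem hz hS hs hvs, smul_eq_C_mul,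
      ← polyAct_colMatrix_X_self s v, ← map_pow]
    exact Dvd.dvd.mul_left (map_dvd _ hX) _

end Invariant

/-! ### Invariants of low degree -/

open scoped LinearAlgebra.Projectivization

instance [Fact p.Prime] : Fintype (ℙ (ZMod p) (Fin n → ZMod p)) := Fintype.ofFinite _

/-- The degree `(p - 2) (1 + p + ⋯ + pⁿ⁻¹)` of the polynomial factor of the class of least positive
degree in `Dₙ`. -/
def bottomPolyDegree (p n : ℕ) : ℕ := (p - 2) * ∑ k ∈ Finset.range n, p ^ k

/-- The product of the `(p - 2)`-nd powers of the linear forms, one for each line of `𝔽_pⁿ`. -/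
def bottomPoly (p n : ℕ) [Fact p.Prime] : P p n :=
  ∏ ℓ : ℙ (ZMod p) (Fin n → ZMod p), linForm ℓ.rep ^ (p - 2)

section BottomDegree

variable [Fact p.Prime]

theorem card_projectivization_mul :
    Fintype.card (ℙ (ZMod p) (Fin n → ZMod p)) * (p - 2) = bottomPolyDegree p n := by
  rw [← Nat.card_eq_fintype_card, Projectivization.card_of_finrank (ZMod p) _
    (Module.finrank_fin_fun (ZMod p)), Nat.card_zmod, mul_comm, bottomPolyDegree]

theorem bottomPoly_isHomogeneous : (bottomPoly p n).IsHomogeneous (bottomPolyDegree p n) := by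
  rw [← card_projectivization_mul, ← smul_eq_mul, Fintype.card, ← Finset.sum_const]
  exact prod_linForm_pow_isHomogeneous _ _

theorem sub_length_le_card_lines_vanishing (S : List (Fin n)) :
    n - S.length ≤ Finset.card {ℓ : ℙ (ZMod p) (Fin n → ZMod p) | ∀ s ∈ S, ℓ.rep s = 0} := by
  have hne (k : Fin n) : (Pi.single k 1 : Fin n → ZMod p) ≠ 0 :=
    Pi.single_ne_zero_iff.2 one_ne_zero
  calc n - S.length ≤ n - S.toFinset.card := Nat.sub_le_sub_left S.toFinset_card_le n
    _ = S.toFinsetᶜ.card := by rw [Finset.card_compl, Fintype.card_fin]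
    _ ≤ _ := Finset.card_le_card_of_injOn (fun k => Projectivization.mk (ZMod p) _ (hne k))
      (fun k hk => ?_) fun k _ l _ hkl => ?_
  · rw [Finset.mem_coe, Finset.mem_compl, List.mem_toFinset] at hk
    obtain ⟨a, ha⟩ := Projectivization.exists_smul_eq_mk_rep (ZMod p) _ (hne k)
    refine Finset.mem_filter.2 ⟨Finset.mem_univ _, fun s hs => ?_⟩
    rw [← ha, Pi.smul_apply, Pi.single_eq_of_ne (ne_of_mem_of_not_mem hs hk), smul_zero]
  · obtain ⟨a, ha⟩ := (Projectivization.mk_eq_mk_iff' _ _ _ (hne k) (hne l)).1 hkl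
    by_contra hne
    have hk := congrFun ha k
    rw [Pi.smul_apply, Pi.single_eq_of_ne hne, smul_zero, Pi.single_eq_same] at hk
    exact zero_ne_one hk

section Invariant

variable {z : H p n} {S : List (Fin n)}

theorem bottomPolyDegree_add_le (hz : z ∈ D p n) (hS : S.Nodup) (hS0 : S ≠ []) {j : ℕ}
    (hj : (coeffX S z).IsHomogeneous j) (h0 : coeffX S z ≠ 0) :
    bottomPolyDegree p n + (n - S.length) ≤ j := by
  let e (ℓ : ℙ (ZMod p) (Fin n → ZMod p)) : ℕ := p - 2 + if ∀ s ∈ S, ℓ.rep s = 0 then 1 else 0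
  have hdvd : ∏ ℓ : ℙ (ZMod p) (Fin n → ZMod p), linForm ℓ.rep ^ e ℓ ∣ coeffX S z := by
    refine prod_projectivization_linForm_pow_dvd fun ℓ => ?_
    have hp := (Fact.out : p.Prime).two_le
    by_cases h : ∀ s ∈ S, ℓ.rep s = 0
    · rw [show e ℓ = p - 1 by simp only [e, if_pos h]; omega]
      exact linForm_pow_sub_one_dvd_coeffX hz hS hS0 ℓ.rep_nonzero h
    · rw [show e ℓ = p - 2 by simp only [e, if_neg h, add_zero]]
      exact linForm_pow_sub_two_dvd_coeffX hz hS hS0 ℓ.rep_nonzero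
  calc bottomPolyDegree p n + (n - S.length)
      ≤ bottomPolyDegree p n +
          Finset.card {ℓ : ℙ (ZMod p) (Fin n → ZMod p) | ∀ s ∈ S, ℓ.rep s = 0} :=
        Nat.add_le_add_left (sub_length_le_card_lines_vanishing S) _
    _ = ∑ ℓ, e ℓ := by
        rw [Finset.sum_add_distrib, Finset.sum_boole, Nat.cast_id, Finset.sum_const, smul_eq_mul,
          Finset.card_univ, card_projectivization_mul]
    _ ≤ j := le_of_dvd_of_isHomogeneous (prod_linForm_pow_isHomogeneous _ _) hj h0 hdvd

theorem exists_coeffX_eq_smul_bottomPoly (hz : z ∈ D p n) (hS : S.Nodup) (hS0 : S ≠ [])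
    (hj : (coeffX S z).IsHomogeneous (bottomPolyDegree p n)) :
    ∃ c : ZMod p, coeffX S z = c • bottomPoly p n :=
  exists_eq_smul_of_dvd_of_isHomogeneous bottomPoly_isHomogeneous hj <|
    prod_projectivization_linForm_pow_dvd fun ℓ =>
      linForm_pow_sub_two_dvd_coeffX hz hS hS0 ℓ.rep_nonzero

end Invariant

end BottomDegree

section PolynomialInvariant

variable {k : Fin n} {f : P p n}

theorem polyAct_colMatrix_polyAct_colMatrix_zero (v : Fin n → ZMod p) (f : P p n) :
    polyAct (colMatrix k v) (polyAct (colMatrix k 0) f) = polyAct (colMatrix k 0) f := by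
  suffices h : (polyAct (colMatrix k v)).comp (polyAct (colMatrix k 0)) = polyAct (colMatrix k 0)
    from DFunLike.congr_fun h f
  refine algHom_ext fun j => ?_
  rw [AlgHom.comp_apply]
  by_cases hj : j = k
  · rw [hj, polyAct_colMatrix_X_self, show linForm (0 : Fin n → ZMod p) = 0 by simp [linForm],
      map_zero]
  · rw [polyAct_colMatrix_X_of_ne hj, polyAct_colMatrix_X_of_ne hj]

theorem coeff_sub_polyAct_colMatrix_zero (k : Fin n) (f : P p n) (m : Fin n →₀ ℕ) :
    coeff m (f - polyAct (colMatrix k 0) f) = if m k = 0 then 0 else coeff m f := by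
  rw [← Pi.single_zero k, coeff_sub, coeff_polyAct_colMatrix_single, zero_pow_eq]
  split_ifs
  · rw [one_mul, sub_self]
  · rw [zero_mul, sub_zero]

variable [Fact p.Prime]

theorem linForm_pow_dvd_sub_polyAct_colMatrix_zero
    (hf : ∀ v : Fin n → ZMod p, v k ≠ 0 → polyAct (colMatrix k v) f = f) {v : Fin n → ZMod p}
    (hv : v k ≠ 0) : linForm v ^ (p - 1) ∣ f - polyAct (colMatrix k 0) f := by
  have hX : X k ^ (p - 1) ∣ f - polyAct (colMatrix k 0) f := X_pow_dvd_iff.2 fun m hm => by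
    rw [mem_support_iff, coeff_sub_polyAct_colMatrix_zero, ite_ne_left_iff] at hm
    refine Nat.le_of_dvd (Nat.pos_of_ne_zero hm.1) ?_
    rw [← zero_add (m k)]
    refine sub_one_dvd_add_exponent (fun c hc => ?_) (mem_support_iff.2 (Ne.symm hm.2))
    rw [pow_zero, one_smul, hf _ (by rwa [Pi.single_eq_same])]
  have hfix : polyAct (colMatrix k v) (f - polyAct (colMatrix k 0) f) =
      f - polyAct (colMatrix k 0) f := by
    rw [map_sub, hf v hv, polyAct_colMatrix_polyAct_colMatrix_zero]
  rw [← hfix, ← polyAct_colMatrix_X_self k v, ← map_pow]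
  exact map_dvd _ hX

/-- The part of `f` divisible by `y_k` is divisible by `∏ (yₖ + ∑_{i ≠ k} cᵢ yᵢ) ^ (p - 1)`, the
product being over the `pⁿ⁻¹` vectors `c`. -/
theorem sub_one_mul_pow_le_of_polyAct_eq
    (hf : ∀ v : Fin n → ZMod p, v k ≠ 0 → polyAct (colMatrix k v) f = f) {j : ℕ}
    (hj : f.IsHomogeneous j) {m : Fin n →₀ ℕ} (hm : m ∈ f.support) (hmk : m k ≠ 0) :
    (p - 1) * p ^ (n - 1) ≤ j := by
  let V (c : {b : Fin n // b ≠ k} → ZMod p) : Fin n → ZMod p :=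
    (Equiv.funSplitAt k (ZMod p)).symm (1, c)
  have hVk (c) : V c k = 1 := by simp [V]
  have hVk' (c) : V c k ≠ 0 := by rw [hVk]; exact one_ne_zero
  have hV (c c') (hne : c ≠ c') (a : ZMod p) : V c' ≠ a • V c := fun h => by
    have ha : 1 = a := by
      simpa only [hVk, Pi.smul_apply, smul_eq_mul, mul_one] using congrFun h k
    rw [← ha, one_smul] at h
    exact hne (Prod.ext_iff.1 ((Equiv.funSplitAt k (ZMod p)).symm.injective h)).2.symm
  have hdvd : ∏ c, linForm (V c) ^ (p - 1) ∣ f - polyAct (colMatrix k 0) f :=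
    prod_linForm_pow_dvd (fun c h => hVk' c (congrFun h k)) hV
      fun c => linForm_pow_dvd_sub_polyAct_colMatrix_zero hf (hVk' c)
  have hne : f - polyAct (colMatrix k 0) f ≠ 0 := fun h => mem_support_iff.1 hm <| by
    have hcoeff := coeff_sub_polyAct_colMatrix_zero k f m
    rwa [if_neg hmk, h, coeff_zero, eq_comm] at hcoeff
  calc (p - 1) * p ^ (n - 1) = ∑ _c : {b : Fin n // b ≠ k} → ZMod p, (p - 1) := by
        rw [Finset.sum_const, Finset.card_univ, Fintype.card_fun, ZMod.card,
          Fintype.card_subtype_compl, Fintype.card_fin, Fintype.card_subtype_eq, smul_eq_mul,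
          mul_comm]
    _ ≤ j := le_of_dvd_of_isHomogeneous (prod_linForm_pow_isHomogeneous V _)
        (hj.sub (polyAct_isHomogeneous _ hj)) hne hdvd

end PolynomialInvariant

theorem lt_sub_one_mul_pow (hp : 2 ≤ p) (n : ℕ) :
    (n + 1) + 2 * bottomPolyDegree p (n + 1) < 2 * ((p - 1) * p ^ n) := by
  obtain ⟨q, rfl⟩ := Nat.exists_eq_add_of_le' hp
  simp only [bottomPolyDegree, Nat.add_sub_cancel, show q + 2 - 1 = q + 1 from rfl]
  induction n with
  | zero => simp only [zero_add, Finset.sum_range_one, pow_zero, mul_one]; omega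
  | succ n ih =>
    have hpow : 0 < (q + 2) ^ n := by positivity
    have hsplit : (q + 2) ^ (n + 1) = (q + 1) * (q + 2) ^ n + (q + 2) ^ n := by ring
    have hsplit' : (q + 1) * (q + 2) ^ (n + 1) = q * (q + 2) ^ (n + 1) + (q + 2) ^ (n + 1) := by
      ring
    rw [Finset.sum_range_succ, mul_add]
    omega

section LowDegree

variable [Fact p.Prime] {z w : H p n} {k : ℕ} {S : List (Fin n)}

theorem not_isHomogeneous_coeffX_nil (hz : z ∈ D p n) {j : ℕ} (hj0 : 0 < j)
    (hjn : 2 * j ≤ n + 2 * bottomPolyDegree p n) (h0 : coeffX [] z ≠ 0) :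
    ¬(coeffX [] z).IsHomogeneous j := fun hj => by
  obtain ⟨m, hm⟩ := support_nonempty.2 h0
  obtain ⟨b, hb⟩ : ∃ b, m b ≠ 0 := by
    by_contra! h
    have hdeg := hj (mem_support_iff.1 hm)
    rw [show m = 0 from Finsupp.ext h, map_zero] at hdeg
    omega
  have hfix (v : Fin n → ZMod p) (hv : v b ≠ 0) : polyAct (colMatrix b v) (coeffX [] z) =
      coeffX [] z := .symm <|
    coeffX_eq_polyAct_of_notMem hz List.not_mem_nil hv fun s hs => absurd hs List.not_mem_nil
  have hle := sub_one_mul_pow_le_of_polyAct_eq hfix hj hm hb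
  obtain ⟨l, rfl⟩ := Nat.exists_eq_add_one_of_ne_zero (Fin.pos b).ne'
  have hlt := lt_sub_one_mul_pow (Fact.out : p.Prime).two_le l
  rw [Nat.add_sub_cancel] at hle
  omega

theorem length_eq_of_coeffX_ne_zero (hz : z ∈ D p n) (hzk : z ∈ degreePart p n k) (hk : 0 < k)
    (hkn : k ≤ n + 2 * bottomPolyDegree p n) (h0 : coeffX S z ≠ 0) :
    S.length = n ∧ (coeffX S z).IsHomogeneous (bottomPolyDegree p n) := by
  have hS := nodup_of_coeffX_ne_zero h0
  have hlen : S.length ≤ n := by simpa only [Fintype.card_fin] using hS.length_le_card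
  obtain ⟨j, hj, hjh⟩ :=
    exists_isHomogeneous_of_mem_coeffDegree (coeffX_mem_coeffDegree S hzk) h0
  by_cases hS0 : S = []
  · subst hS0
    rw [List.length_nil] at hj
    exact absurd hjh (not_isHomogeneous_coeffX_nil hz (by omega) (by omega) h0)
  · have hle := bottomPolyDegree_add_le hz hS hS0 hjh h0
    have hj' : j = bottomPolyDegree p n := by omega
    exact ⟨by omega, hj' ▸ hjh⟩

theorem finRange_perm_of_coeffX_ne_zero (hz : z ∈ D p n) (hzk : z ∈ degreePart p n k) (hk : 0 < k)
    (hkn : k ≤ n + 2 * bottomPolyDegree p n) (h0 : coeffX S z ≠ 0) :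
    (List.finRange n).Perm S := by
  have hS := nodup_of_coeffX_ne_zero h0
  have hlen := (length_eq_of_coeffX_ne_zero hz hzk hk hkn h0).1
  refine List.perm_of_nodup_nodup_toFinset_eq (List.nodup_finRange n) hS ?_
  rw [List.toFinset_finRange, eq_comm, ← Finset.card_eq_iff_eq_univ,
    List.toFinset_card_of_nodup hS, hlen, Fintype.card_fin]

theorem eq_zero_of_coeffX_finRange_eq_zero (hz : z ∈ D p n) (hzk : z ∈ degreePart p n k)
    (hk : 0 < k) (hkn : k ≤ n + 2 * bottomPolyDegree p n)
    (h0 : coeffX (List.finRange n) z = 0) : z = 0 :=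
  eq_zero_of_coeffX_eq_zero fun _ => by_contra fun h =>
    h (coeffX_eq_zero_of_perm (finRange_perm_of_coeffX_ne_zero hz hzk hk hkn h) h0)

theorem exists_coeffX_finRange_eq_smul (hz : z ∈ D p n) (hzk : z ∈ degreePart p n k) (hk : 0 < k)
    (hkn : k ≤ n + 2 * bottomPolyDegree p n) :
    ∃ c : ZMod p, coeffX (List.finRange n) z = c • bottomPoly p n := by
  by_cases h0 : coeffX (List.finRange n) z = 0
  · exact ⟨0, by rw [h0, zero_smul]⟩
  · refine exists_coeffX_eq_smul_bottomPoly hz (List.nodup_finRange n) ?_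
      (length_eq_of_coeffX_ne_zero hz hzk hk hkn h0).2
    rw [ne_eq, List.finRange_eq_nil_iff]
    rintro rfl
    simp only [bottomPolyDegree, Finset.sum_range_zero, mul_zero] at hkn
    omega

theorem exists_eq_smul_of_mem_degreePart (hz : z ∈ D p n) (hw : w ∈ D p n)
    (hzk : z ∈ degreePart p n k) (hwk : w ∈ degreePart p n k) (hk : 0 < k)
    (hkn : k ≤ n + 2 * bottomPolyDegree p n) (hw0 : w ≠ 0) : ∃ c : ZMod p, z = c • w := by
  obtain ⟨a, ha⟩ := exists_coeffX_finRange_eq_smul hz hzk hk hkn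
  obtain ⟨b, hb⟩ := exists_coeffX_finRange_eq_smul hw hwk hk hkn
  have hb0 : b ≠ 0 := by
    rintro rfl
    exact hw0 (eq_zero_of_coeffX_finRange_eq_zero hw hwk hk hkn (by rw [hb, zero_smul]))
  refine ⟨a / b, sub_eq_zero.1 (eq_zero_of_coeffX_finRange_eq_zero (k := k) ?_ ?_ hk hkn ?_)⟩
  · exact (dicksonSubalgebra p n).sub_mem hz ((dicksonSubalgebra p n).smul_mem hw _)
  · exact Submodule.sub_mem _ hzk (Submodule.smul_mem _ _ hwk)
  · rw [map_sub, LinearMap.map_smul_of_tower, ha, hb, smul_smul, div_mul_cancel₀ _ hb0, sub_self]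

end LowDegree

/-! ### The bottom class -/

theorem polyAct_mooreMatrix_det [Fact p.Prime] (A : Matrix (Fin n) (Fin n) (ZMod p))
    (g : Fin n → ℕ) :
    polyAct A (mooreMatrix p g).det = A.det • (mooreMatrix p g).det := by
  have h : (polyAct A).mapMatrix (mooreMatrix p g) =
      mooreMatrix p g * (algebraMap (ZMod p) (P p n)).mapMatrix A := by
    refine Matrix.ext fun i j => ?_
    rw [Matrix.mul_apply]
    change polyAct A (X j ^ p ^ g i) = ∑ l, X l ^ p ^ g i * algebraMap (ZMod p) (P p n) (A l j)
    rw [map_pow, polyAct_X, linForm, sum_pow_char_pow]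
    refine Finset.sum_congr rfl fun l _ => ?_
    rw [smul_pow, ZMod.pow_card_pow, Algebra.smul_def, mul_comm]
  rw [AlgHom.map_det, h, Matrix.det_mul, ← RingHom.map_det, Algebra.smul_def, mul_comm]

section TopForm

theorem alternatingMap_apply_eq_det_smul {ι R M N : Type*} [Fintype ι] [DecidableEq ι]
    [CommRing R] [AddCommGroup M] [Module R M] [AddCommGroup N] [Module R N]
    (e : Module.Basis ι R M) (f : M [⋀^ι]→ₗ[R] N) (v : ι → M) : f v = e.det v • f e := by
  suffices h : f = (LinearMap.toSpanSingleton R N (f e)).compAlternatingMap e.det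
    from DFunLike.congr_fun h v
  refine Module.Basis.ext_alternating e fun s hs => ?_
  let σ : Equiv.Perm ι := Equiv.ofBijective s hs.bijective_of_finite
  change f (e ∘ σ) = LinearMap.compAlternatingMap _ e.det (e ∘ σ)
  rw [AlternatingMap.map_perm, AlternatingMap.map_perm, LinearMap.compAlternatingMap_apply,
    e.det_self, LinearMap.toSpanSingleton_apply, one_smul]

variable (R : Type*) [CommRing R]

/-- The top form `x₁ ∧ ⋯ ∧ xₙ` of the exterior algebra of `Rⁿ`. -/
def topForm (n : ℕ) : ExteriorAlgebra R (Fin n → R) :=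
  ExteriorAlgebra.ιMulti R n (Pi.basisFun R (Fin n))

theorem topForm_mem (n : ℕ) : topForm R n ∈ (⋀[R]^n (Fin n → R)) :=
  ExteriorAlgebra.ιMulti_range R n ⟨_, rfl⟩

variable {R}

theorem map_topForm (A : Matrix (Fin n) (Fin n) R) :
    ExteriorAlgebra.map (Matrix.mulVecLin A) (topForm R n) = A.det • topForm R n := by
  rw [topForm, ExteriorAlgebra.map_apply_ιMulti,
    alternatingMap_apply_eq_det_smul (Pi.basisFun R (Fin n)), Module.Basis.det_comp,
    Module.Basis.det_self, mul_one, ← Matrix.toLin'_apply', LinearMap.det_toLin']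

theorem exists_dual_topForm_eq_one (n : ℕ) :
    ∃ φ : Module.Dual R (ExteriorAlgebra R (Fin n → R)), φ (topForm R n) = 1 := by
  refine ⟨ExteriorAlgebra.liftAlternating fun i =>
    if h : i = n then h ▸ (Pi.basisFun R (Fin n)).det else 0, ?_⟩
  rw [topForm, ExteriorAlgebra.liftAlternating_apply_ιMulti, dif_pos rfl]
  exact Module.Basis.det_self _

end TopForm

theorem tensor_topForm_ne_zero {q : P p n} (hq : q ≠ 0) : tensor (topForm (ZMod p) n) q ≠ 0 := by
  obtain ⟨φ, hφ⟩ := exists_dual_topForm_eq_one (R := ZMod p) n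
  intro h
  have hmap := congrArg (TensorProduct.lid (ZMod p) (P p n) ∘ φ.rTensor (P p n))
    (show topForm (ZMod p) n ⊗ₜ[ZMod p] q = 0 from h)
  simp only [Function.comp_apply, LinearMap.rTensor_tmul, hφ, TensorProduct.lid_tmul, one_smul,
    map_zero] at hmap
  exact hq hmap

theorem exists_bottomClass (p n : ℕ) [Fact p.Prime] :
    ∃ w ∈ D p n, w ∈ degreePart p n (n + 2 * bottomPolyDegree p n) ∧ w ≠ 0 := by
  have hp := (Fact.out : p.Prime).two_le
  refine ⟨tensor (topForm (ZMod p) n) ((mooreMatrix p fun i : Fin n => (i : ℕ)).det ^ (p - 2)),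
    mem_D.2 fun g => ?_, tensor_mem_degreePart rfl (topForm_mem _ n) ?_,
    tensor_topForm_ne_zero (pow_ne_zero _ (mooreMatrix_det_ne_zero Fin.val_injective))⟩
  · rw [act_tensor, map_topForm, map_pow, polyAct_mooreMatrix_det, smul_pow, tensor_smul_comm,
      smul_smul, ← pow_succ', show p - 2 + 1 = p - 1 by omega, ZMod.pow_card_sub_one_eq_one,
      one_smul]
    exact ((Matrix.isUnit_iff_isUnit_det _).1 g.isUnit).ne_zero
  · rw [bottomPolyDegree, mul_comm, ← Fin.sum_univ_eq_sum_range]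
    exact (mooreMatrix_det_isHomogeneous _).pow _

/-! ### Endomorphisms of the extended Dickson algebra -/

theorem pos_of_mem_degreePart {k : ℕ} {z : H p n} (hk : 0 < k) (hz : z ∈ degreePart p n k)
    (h0 : z ≠ 0) : 0 < n := by
  obtain ⟨S, j, hj, hS0, hhom⟩ := exists_coeffX_ne_zero hz h0
  cases S with
  | nil =>
    rw [List.length_nil, zero_add] at hj
    obtain ⟨m, hm⟩ := support_nonempty.2 hS0
    have hdeg := hhom (mem_support_iff.1 hm)
    refine Nat.pos_of_ne_zero fun hn => ?_
    subst hn
    rw [Subsingleton.elim m 0, map_zero] at hdeg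
    omega
  | cons s S => exact Fin.pos s

theorem bijOn_iSup_of_iSupIndep {ι M : Type*} [AddCommGroup M] {A : ι → AddSubgroup M}
    (hA : iSupIndep A) {f : M →+ M} (hf : ∀ i, Set.BijOn f (A i) (A i)) :
    Set.BijOn f (⨆ i, A i : AddSubgroup M) (⨆ i, A i : AddSubgroup M) := by
  classical
  have hmaps : ⨆ i, A i ≤ (⨆ i, A i).comap f :=
    iSup_le fun i _ ha => AddSubgroup.mem_iSup_of_mem i ((hf i).mapsTo ha)
  have hsurj : ⨆ i, A i ≤ (⨆ i, A i).map f := iSup_le fun i b hb => by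
    obtain ⟨a, ha, rfl⟩ := (hf i).surjOn hb
    exact ⟨a, AddSubgroup.mem_iSup_of_mem i ha, rfl⟩
  let sum : (Π₀ i, A i) →+ M := DFinsupp.sumAddHom fun i => (A i).subtype
  let F : (Π₀ i, A i) →+ Π₀ i, A i :=
    DFinsupp.mapRange.addMonoidHom fun i => f.restrict (hf i).mapsTo
  have hsum : f.comp sum = sum.comp F := DFinsupp.addHom_ext fun i a => by
    simp only [sum, F, AddMonoidHom.comp_apply, DFinsupp.sumAddHom_single,
      DFinsupp.mapRange.addMonoidHom_apply, DFinsupp.mapRange_single]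
    rfl
  have hF : Function.Injective F := DFinsupp.mapRange_injective _ (fun i => map_zero _) |>.2
    fun i _ _ hab => Subtype.ext ((hf i).injOn (Subtype.coe_prop _) (Subtype.coe_prop _)
      (congrArg Subtype.val hab))
  have hrange : ⨆ i, A i ≤ sum.range := iSup_le fun i a ha =>
    ⟨DFinsupp.single i ⟨a, ha⟩, DFinsupp.sumAddHom_single _ i _⟩
  refine ⟨hmaps, fun x hx y hy hxy => ?_, hsurj⟩
  obtain ⟨a, rfl⟩ := hrange hx
  obtain ⟨b, rfl⟩ := hrange hy
  have hab : sum (F a) = sum (F b) := by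
    rwa [← AddMonoidHom.comp_apply, ← AddMonoidHom.comp_apply, ← hsum]
  exact congrArg sum (hF (hA.dfinsuppSumAddHom_injective hab))

section Endomorphism

variable [Fact p.Prime] {f : D p n →ₗ[SteenrodAlgebra p] D p n}

theorem eigenvalue_unique {c c' : ZMod p} {k k' : ℕ} (hk : 0 < k) (hk' : 0 < k') {z z' : D p n}
    (hz : z ∈ DDegree p n k) (hz' : z' ∈ DDegree p n k') (h0 : z ≠ 0) (h0' : z' ≠ 0)
    (hc : f z = c • z) (hc' : f z' = c' • z') : c = c' := by
  let eigenspace (a : ZMod p) : Submodule (SteenrodAlgebra p) (H p n) :=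
    (LinearMap.eqLocus f (a • LinearMap.id)).map (D p n).subtype
  have hle (a : ZMod p) : eigenspace a ≤ D p n := Submodule.map_subtype_le _ _
  have hinf : eigenspace c ⊓ eigenspace c' ≠ ⊥ :=
    inf_ne_bot_of_mem_degreePart (hle c) (hle c') hk hk' hz hz' ⟨z, hc, rfl⟩ ⟨z', hc', rfl⟩
      (fun h => h0 (Subtype.ext h)) (fun h => h0' (Subtype.ext h))
  obtain ⟨_, ⟨⟨w, hw, rfl⟩, ⟨w', hw', hww'⟩⟩, hw0⟩ := (Submodule.ne_bot_iff _).1 hinf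
  obtain rfl : w' = w := Subtype.ext hww'
  have hww : c • (w' : H p n) = c' • (w' : H p n) := congrArg Subtype.val (hw.symm.trans hw')
  exact smul_left_injective (ZMod p) hw0 hww

theorem bijOn_DDegree {k : ℕ} (hf : ∀ z ∈ DDegree p n k, f z ∈ DDegree p n k)
    (hinj : ∀ z ∈ DDegree p n k, f z = 0 → z = 0) :
    Set.BijOn f (DDegree p n k) (DDegree p n k) :=
  ((DDegree_finite k).injOn_iff_bijOn_of_mapsTo hf).1 fun a ha b hb h =>
    sub_eq_zero.1 (hinj _ (sub_mem ha hb) (by rw [map_sub, h, sub_self]))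

theorem bottomDegree_le {r : ℕ} (hr : IsLeast {k : ℕ | 0 < k ∧ DDegree p n k ≠ ⊥} r) :
    r ≤ n + 2 * bottomPolyDegree p n := by
  obtain ⟨⟨hr0, hbot⟩, hleast⟩ := hr
  obtain ⟨y, hy0⟩ := AddSubgroup.ne_bot_iff_exists_ne_zero.1 hbot
  have hn := pos_of_mem_degreePart hr0 y.2 fun h => hy0 (Subtype.ext (Subtype.ext h))
  obtain ⟨w, hwD, hw, hw0⟩ := exists_bottomClass p n
  refine hleast ⟨by omega, fun h => hw0 ?_⟩
  have hmem : (⟨w, hwD⟩ : D p n) ∈ DDegree p n (n + 2 * bottomPolyDegree p n) := hw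
  rw [h, AddSubgroup.mem_bot] at hmem
  exact congrArg Subtype.val hmem

theorem exists_map_eq_smul_of_mem_bottomDegree {r : ℕ}
    (hr : IsLeast {k : ℕ | 0 < k ∧ DDegree p n k ≠ ⊥} r)
    (hf : ∀ z ∈ DDegree p n r, f z ∈ DDegree p n r) {y : D p n} (hy : y ∈ DDegree p n r)
    (hy0 : y ≠ 0) : ∃ c : ZMod p, f y = c • y := by
  obtain ⟨c, hc⟩ := exists_eq_smul_of_mem_degreePart (f y).2 y.2 (hf y hy) hy hr.1.1
    (bottomDegree_le hr) fun h => hy0 (Subtype.ext h)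
  exact ⟨c, Subtype.ext hc⟩

theorem eq_zero_of_map_eq_zero {r : ℕ} (hr : IsLeast {k : ℕ | 0 < k ∧ DDegree p n k ≠ ⊥} r)
    (hf : ∀ z ∈ DDegree p n r, f z ∈ DDegree p n r) (hfr : ∃ z ∈ DDegree p n r, f z ≠ 0)
    {k : ℕ} (hk : 0 < k) {z : D p n} (hz : z ∈ DDegree p n k) (hfz : f z = 0) : z = 0 := by
  obtain ⟨y, hy, hfy⟩ := hfr
  have hy0 : y ≠ 0 := fun h => hfy (by rw [h, map_zero])
  obtain ⟨c, hc⟩ := exists_map_eq_smul_of_mem_bottomDegree hr hf hy hy0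
  by_contra hz0
  have h0 : 0 = c :=
    eigenvalue_unique hk hr.1.1 hz hy hz0 hy0 (by rw [hfz, zero_smul]) hc
  exact hfy (by rw [hc, ← h0, zero_smul])

theorem bijOn_DAugmentation (hf : ∀ k, 0 < k → Set.BijOn f (DDegree p n k) (DDegree p n k)) :
    Set.BijOn f (DAugmentation p n) (DAugmentation p n) := by
  rw [DAugmentation, iSup_subtype']
  exact bijOn_iSup_of_iSupIndep (f := f.toAddMonoidHom)
    (iSupIndep_DDegree.comp (f := ((↑) : {k : ℕ // 0 < k} → ℕ)) Subtype.val_injective)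
    fun k => hf k k.2

theorem bijective_of_bijOn_DDegree (hf : ∀ k, Set.BijOn f (DDegree p n k) (DDegree p n k)) :
    Function.Bijective f := by
  have h := bijOn_iSup_of_iSupIndep (f := f.toAddMonoidHom) iSupIndep_DDegree hf
  rw [iSup_DDegree, AddSubgroup.coe_top] at h
  exact Set.bijOn_univ.1 h

theorem eq_zero_of_mem_DDegree_zero (h1 : f 1 ≠ 0) {z : D p n} (hz : z ∈ DDegree p n 0)
    (hfz : f z = 0) : z = 0 := by
  obtain ⟨c, rfl⟩ := exists_eq_smul_one_of_mem_DDegree_zero hz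
  rw [LinearMap.map_smul_of_tower] at hfz
  rw [(smul_eq_zero.1 hfz).resolve_right h1, zero_smul]

theorem bijective_iff_map_one_ne_zero (hf : ∀ k, ∀ z ∈ DDegree p n k, f z ∈ DDegree p n k)
    (hpos : ∀ k, 0 < k → Set.BijOn f (DDegree p n k) (DDegree p n k)) :
    Function.Bijective f ↔ f 1 ≠ 0 := by
  refine ⟨fun h h1 => ?_, fun h1 => bijective_of_bijOn_DDegree fun k => ?_⟩
  · have h0 : (1 : D p n) = 0 := h.injective (h1.trans (map_zero f).symm)
    have hone := congrArg polyPart (show (1 : H p n) = 0 from congrArg Subtype.val h0)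
    rw [← map_one (algebraMap (P p n) (H p n)), polyPart_algebraMap, map_zero] at hone
    exact one_ne_zero hone
  · rcases k.eq_zero_or_pos with rfl | hk
    · exact bijOn_DDegree (hf 0) fun z => eq_zero_of_mem_DDegree_zero h1
    · exact hpos k hk

end Endomorphism

end ExtendedDickson

end

theorem theorem4_general (p n : ℕ) [Fact p.Prime]
    (f : ExtendedDickson.D p n →ₗ[ExtendedDickson.SteenrodAlgebra p] ExtendedDickson.D p n)
    (hf : ∀ k : ℕ, ∀ z ∈ ExtendedDickson.DDegree p n k, f z ∈ ExtendedDickson.DDegree p n k)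
    (r : ℕ) (hr : IsLeast {k : ℕ | 0 < k ∧ ExtendedDickson.DDegree p n k ≠ ⊥} r)
    (hfr : ∃ z ∈ ExtendedDickson.DDegree p n r, f z ≠ 0) :
    (∀ k : ℕ, 0 < k → Set.BijOn f (ExtendedDickson.DDegree p n k) (ExtendedDickson.DDegree p n k)) ∧
    Set.BijOn f (ExtendedDickson.DAugmentation p n) (ExtendedDickson.DAugmentation p n) ∧
    (Function.Bijective f ↔ f 1 ≠ 0) := by
  open ExtendedDickson in
  have hpos : ∀ k, 0 < k → Set.BijOn f (DDegree p n k) (DDegree p n k) := fun k hk =>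
    bijOn_DDegree (hf k) fun z => eq_zero_of_map_eq_zero hr (hf r) hfr hk
  exact ⟨hpos, bijOn_DAugmentation hpos, bijective_iff_map_one_ne_zero hf hpos⟩

theorem theorem4 (p n : ℕ) [Fact p.Prime] (hp : p ≠ 2)
    (f : ExtendedDickson.D p n →ₗ[ExtendedDickson.SteenrodAlgebra p] ExtendedDickson.D p n)
    (hf : ∀ k : ℕ, ∀ z ∈ ExtendedDickson.DDegree p n k, f z ∈ ExtendedDickson.DDegree p n k)
    (r : ℕ) (hr : IsLeast {k : ℕ | 0 < k ∧ ExtendedDickson.DDegree p n k ≠ ⊥} r)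
    (hfr : ∃ z ∈ ExtendedDickson.DDegree p n r, f z ≠ 0) :
    (∀ k : ℕ, 0 < k → Set.BijOn f (ExtendedDickson.DDegree p n k) (ExtendedDickson.DDegree p n k)) ∧
    Set.BijOn f (ExtendedDickson.DAugmentation p n) (ExtendedDickson.DAugmentation p n) ∧
    (Function.Bijective f ↔ f 1 ≠ 0) :=
  theorem4_general p n f hf r hr hfr
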